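/- Let $K$ be an algebraically closed field of characteristic zero. For a finite-dimensional Lie algebra $\mathfrak g$ over $K$ put $\operatorname{ind}\mathfrak g=\min_{f\in\mathfrak g^*}\dim\ker B_f$, where $B_f(x,y)=f([x,y])$; $\mathfrak g$ is called Frobenius if $\operatorname{ind}\mathfrak g=0$. For a positive integer $n$ let $\mathfrak{sp}(2n)$ be the Lie algebra of matrices $\begin{bmatrix}A&B\\ C&-\widehat A\end{bmatrix}$ with $A,B,C\in K^{n\times n}$, $B=\widehat B$, $C=\widehat C$, where $\widehat{\ }$ is the transpose with respect to the antidiagonal. It has the triangular decomposition $\mathfrak u_+\oplus\mathfrak h\oplus\mathfrak u_-$ into strictly upper triangular, diagonal and strictly lower triangular matrices, and simple roots $\alpha_1,\dots,\alpha_n$ in the standard order, $\alpha_n$ being the long root. For positive integers $a,b$ with $a+b\le n$ and $c\le n$ let $\mathfrak p_n^{C}((a,b)\mid(c))=\mathfrak p\cap\mathfrak p'$ be the seaweed subalgebra of $\mathfrak{sp}(2n)$ in which $\mathfrak p\supseteq\mathfrak h\oplus\mathfrak u_+$ is the parabolic subalgebra such that the simple roots $\alpha$ with $\mathfrak g_{-\alpha}\not\subseteq\mathfrak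 p$ are exactly $\alpha_a$ and $\alpha_{a+b}$, and $\mathfrak p'\supseteq\mathfrak h\oplus\mathfrak u_-$ is the parabolic subalgebra such that the only simple root $\alpha$ with $\mathfrak g_{\alpha}\not\subseteq\mathfrak p'$ is $\alpha_c$. (Equivalently, with $F_k$ the span of the first $k$ standard basis vectors and $F_k'$ the span of the last $2n-k$ ones, it consists of the matrices in $\mathfrak{sp}(2n)$ that map each of $F_a$, $F_{a+b}$ and $F'_c$ into itself.) Theorem. Let $a,b,c,n$ be positive integers with $a+b=n$ and $c\le n$. Then $\operatorname{ind}\mathfrak p_n^{C}((a,b)\mid(c))=0$, that is, $\mathfrak p_n^{C}((a,b)\mid(c))$ is Frobenius, if and only if one of the following conditions holds: (i) $c=n-1$ and $\gcd(a+b,b+c)=1$; (ii) $c=n-2$ and $\gcd(a+b,b+c)=1$; (iii) $c=n-3$, the integers $a$, $b$, $c$ are all odd, and $\gcd(a+b,b+c)=2$. -/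

import Mathlib

namespace SymplecticSeaweed

open LieAlgebra

attribute [local instance 100] LieRing.ofAssociativeRing

section Index

variable (K L : Type*) [Field K] [LieRing L] [LieAlgebra K L]

/-- The Kirillov form `B_f (x, y) = f ⁅x, y⁆` of a linear functional `f` on a Lie algebra. -/
def kirillovForm (f : Module.Dual K L) : LinearMap.BilinForm K L :=
  LinearMap.mk₂ K (fun x y => f ⁅x, y⁆)
    (fun x x' y => by rw [add_lie, map_add]) (fun t x y => by rw [smul_lie, map_smul])
    (fun x y y' => by rw [lie_add, map_add]) (fun t x y => by rw [lie_smul, map_smul])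

/-- The index of a finite-dimensional Lie algebra: the minimum over all linear functionals `f`
of the dimension of the kernel of `B_f` (an infimum of a nonempty set of natural numbers, so it is
attained). -/
noncomputable def index : ℕ :=
  ⨅ f : Module.Dual K L, Module.finrank K (LinearMap.ker (kirillovForm K L f))

end Index

section Seaweed

variable (K : Type*) [Field K] (n : ℕ)

/-- `𝔰𝔭(2n)` is Mathlib's `Symplectic.sp (Fin n) K`, the matrices `[A, B; C, -Aᵀ]` with `B` and `C`
symmetric, acting on `K ^ (2n)` with basis `e₁, …, eₙ, f₁, …, fₙ`. We order the basis as
`e₁ < ⋯ < eₙ < fₙ < ⋯ < f₁`; listing rows and columns in this order turns the matrices into those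
of the form `[A, B; C, -Â]` with `B = B̂`, `C = Ĉ`, where the hat is the transpose with respect to
the antidiagonal. `pos` is the (zero-based) position in this order. -/
def pos : Fin n ⊕ Fin n → ℕ
  | Sum.inl i => i
  | Sum.inr i => 2 * n - 1 - i

/-- Matrices that map the span of the first `k` basis vectors into itself. -/
def stabFirst (k : ℕ) : LieSubalgebra K (Matrix (Fin n ⊕ Fin n) (Fin n ⊕ Fin n) K) where
  carrier := {X | ∀ i j, pos n j < k → k ≤ pos n i → X i j = 0}
  add_mem' := fun hX hY i j hj hi => by
    rw [Matrix.add_apply, hX i j hj hi, hY i j hj hi, add_zero]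
  zero_mem' := fun _ _ _ _ => rfl
  smul_mem' := fun t X hX i j hj hi => by
    rw [Matrix.smul_apply, hX i j hj hi, smul_zero]
  lie_mem' := by
    intro X Y hX hY i j hj hi
    have key : ∀ X Y : Matrix (Fin n ⊕ Fin n) (Fin n ⊕ Fin n) K,
        (∀ i j, pos n j < k → k ≤ pos n i → X i j = 0) →
        (∀ i j, pos n j < k → k ≤ pos n i → Y i j = 0) → (X * Y) i j = 0 := by
      intro X Y hX hY
      rw [Matrix.mul_apply]
      refine Finset.sum_eq_zero fun l _ => ?_
      rcases lt_or_ge (pos n l) k with h | h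
      · rw [hX i l h hi, zero_mul]
      · rw [hY l j hj h, mul_zero]
    rw [LieRing.of_associative_ring_bracket, Matrix.sub_apply, key X Y hX hY, key Y X hY hX,
      sub_zero]

/-- Matrices that map the span of all but the first `k` basis vectors into itself. -/
def stabLast (k : ℕ) : LieSubalgebra K (Matrix (Fin n ⊕ Fin n) (Fin n ⊕ Fin n) K) where
  carrier := {X | ∀ i j, pos n i < k → k ≤ pos n j → X i j = 0}
  add_mem' := fun hX hY i j hi hj => by
    rw [Matrix.add_apply, hX i j hi hj, hY i j hi hj, add_zero]
  zero_mem' := fun _ _ _ _ => rfl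
  smul_mem' := fun t X hX i j hi hj => by
    rw [Matrix.smul_apply, hX i j hi hj, smul_zero]
  lie_mem' := by
    intro X Y hX hY i j hi hj
    have key : ∀ X Y : Matrix (Fin n ⊕ Fin n) (Fin n ⊕ Fin n) K,
        (∀ i j, pos n i < k → k ≤ pos n j → X i j = 0) →
        (∀ i j, pos n i < k → k ≤ pos n j → Y i j = 0) → (X * Y) i j = 0 := by
      intro X Y hX hY
      rw [Matrix.mul_apply]
      refine Finset.sum_eq_zero fun l _ => ?_
      rcases lt_or_ge (pos n l) k with h | h
      · rw [hY l j h hj, mul_zero]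
      · rw [hX i l hi h, zero_mul]
    rw [LieRing.of_associative_ring_bracket, Matrix.sub_apply, key X Y hX hY, key Y X hY hX,
      sub_zero]

/-- The standard parabolic subalgebra `𝔭 ⊇ 𝔥 ⊕ 𝔲₊` of `𝔰𝔭(2n)` attached to a set `Ψ` of simple
roots: the stabilizer of the isotropic flag made of the spans of the first `k` basis vectors,
`α_k ∈ Ψ`. A set of simple roots `α_1, …, α_n` is given by the set of its indices. The simple roots
`α` with `𝔤_{-α} ⊄ 𝔭` are exactly those in `Ψ`, see `negSimpleRootVector_mem_parabolic`. -/
def parabolic (Ψ : Set ℕ) : LieSubalgebra K (Matrix (Fin n ⊕ Fin n) (Fin n ⊕ Fin n) K) :=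
  Symplectic.sp (Fin n) K ⊓ ⨅ k ∈ Ψ, stabFirst K n k

/-- The standard parabolic subalgebra `𝔭' ⊇ 𝔥 ⊕ 𝔲₋` of `𝔰𝔭(2n)` attached to a set `Ψ'` of simple
roots, the simple roots `α` with `𝔤_α ⊄ 𝔭'`. -/
def oppParabolic (Ψ' : Set ℕ) : LieSubalgebra K (Matrix (Fin n ⊕ Fin n) (Fin n ⊕ Fin n) K) :=
  Symplectic.sp (Fin n) K ⊓ ⨅ k ∈ Ψ', stabLast K n k

/-- The indices of the simple roots attached to a string of positive integers `(a₁, …, a_m)` of sum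
at most `n`: the partial sums `a₁`, `a₁ + a₂`, …, `a₁ + ⋯ + a_m`. -/
def simpleRootsOf (a : List ℕ) : Set ℕ :=
  {k | ∃ m, 1 ≤ m ∧ m ≤ a.length ∧ k = (a.take m).sum}

/-- The seaweed subalgebra `𝔭ₙ^C(a | b)` of `𝔰𝔭(2n)`. -/
def seaweed (a b : List ℕ) : LieSubalgebra K (Matrix (Fin n ⊕ Fin n) (Fin n ⊕ Fin n) K) :=
  parabolic K n (simpleRootsOf a) ⊓ oppParabolic K n (simpleRootsOf b)

/-! Checks that the parabolic subalgebras are the intended ones. -/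

variable {K n}

theorem mem_sp_iff (X : Matrix (Fin n ⊕ Fin n) (Fin n ⊕ Fin n) K) :
    X ∈ Symplectic.sp (Fin n) K ↔
      X.toBlocks₂₂ = -X.toBlocks₁₁.transpose ∧ X.toBlocks₁₂.IsSymm ∧ X.toBlocks₂₁.IsSymm := by
  rw [Symplectic.sp, mem_skewAdjointMatricesLieSubalgebra, mem_skewAdjointMatricesSubmodule]
  obtain ⟨A, B, C, D, rfl⟩ : ∃ A B C D, X = Matrix.fromBlocks A B C D :=
    ⟨_, _, _, _, (Matrix.fromBlocks_toBlocks X).symm⟩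
  simp only [Matrix.IsSkewAdjoint, Matrix.IsAdjointPair, Matrix.J, Matrix.fromBlocks_transpose,
    Matrix.fromBlocks_multiply, Matrix.fromBlocks_neg, Matrix.fromBlocks_inj, Matrix.IsSymm,
    Matrix.toBlocks_fromBlocks₁₁, Matrix.toBlocks_fromBlocks₁₂, Matrix.toBlocks_fromBlocks₂₁,
    Matrix.toBlocks_fromBlocks₂₂, mul_zero, zero_mul, mul_one, one_mul, zero_add, add_zero,
    mul_neg, neg_mul, neg_zero, neg_neg]
  constructor
  · rintro ⟨h1, h2, h3, h4⟩
    exact ⟨h2.symm, neg_inj.mp h4, h1⟩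
  · rintro ⟨h1, h2, h3⟩
    refine ⟨h3, h1.symm, ?_, neg_inj.mpr h2⟩
    rw [h1, Matrix.transpose_neg, Matrix.transpose_transpose]

theorem mem_parabolic (Ψ : Set ℕ) (X : Matrix (Fin n ⊕ Fin n) (Fin n ⊕ Fin n) K) :
    X ∈ parabolic K n Ψ ↔ X ∈ Symplectic.sp (Fin n) K ∧
      ∀ k ∈ Ψ, ∀ i j, pos n j < k → k ≤ pos n i → X i j = 0 := by
  rw [parabolic, LieSubalgebra.mem_inf]
  refine and_congr_right fun _ => ?_
  rw [← SetLike.mem_coe, iInf, LieSubalgebra.coe_sInf]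
  simp only [Set.mem_range, Set.iInter_exists, Set.iInter_iInter_eq', iInf,
    LieSubalgebra.coe_sInf, Set.mem_iInter]
  rfl

theorem mem_oppParabolic (Ψ : Set ℕ) (X : Matrix (Fin n ⊕ Fin n) (Fin n ⊕ Fin n) K) :
    X ∈ oppParabolic K n Ψ ↔ X ∈ Symplectic.sp (Fin n) K ∧
      ∀ k ∈ Ψ, ∀ i j, pos n i < k → k ≤ pos n j → X i j = 0 := by
  rw [oppParabolic, LieSubalgebra.mem_inf]
  refine and_congr_right fun _ => ?_
  rw [← SetLike.mem_coe, iInf, LieSubalgebra.coe_sInf]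
  simp only [Set.mem_range, Set.iInter_exists, Set.iInter_iInter_eq', iInf,
    LieSubalgebra.coe_sInf, Set.mem_iInter]
  rfl

/-- Every matrix of `𝔰𝔭(2n)` that is upper triangular in the chosen order is in `parabolic`. -/
theorem upperTriangular_mem_parabolic (Ψ : Set ℕ)
    {X : Matrix (Fin n ⊕ Fin n) (Fin n ⊕ Fin n) K} (hX : X ∈ Symplectic.sp (Fin n) K)
    (hu : ∀ i j, pos n j < pos n i → X i j = 0) : X ∈ parabolic K n Ψ :=
  (mem_parabolic Ψ X).mpr ⟨hX, fun _ _ i j hj hi => hu i j (hj.trans_le hi)⟩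

/-- Every matrix of `𝔰𝔭(2n)` that is lower triangular in the chosen order is in `oppParabolic`. -/
theorem lowerTriangular_mem_oppParabolic (Ψ : Set ℕ)
    {X : Matrix (Fin n ⊕ Fin n) (Fin n ⊕ Fin n) K} (hX : X ∈ Symplectic.sp (Fin n) K)
    (hu : ∀ i j, pos n i < pos n j → X i j = 0) : X ∈ oppParabolic K n Ψ :=
  (mem_oppParabolic Ψ X).mpr ⟨hX, fun _ _ i j hj hi => hu i j (hj.trans_le hi)⟩

variable (K) in
/-- A generator of the root space of `-α_{k+1}`, `k < n`: it is `E_{e_{k+2}, e_{k+1}} -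
E_{f_{k+1}, f_{k+2}}` if `k + 1 < n` and `E_{f_n, e_n}` for the exceptional root `α_n`. Its
transpose generates the root space of `α_{k+1}`. -/
def negSimpleRootVector (k : Fin n) : Matrix (Fin n ⊕ Fin n) (Fin n ⊕ Fin n) K :=
  if h : (k : ℕ) + 1 < n then
    Matrix.single (Sum.inl ⟨k + 1, h⟩) (Sum.inl k) 1 -
      Matrix.single (Sum.inr k) (Sum.inr ⟨k + 1, h⟩) 1
  else Matrix.single (Sum.inr k) (Sum.inl k) 1

theorem negSimpleRootVector_mem_sp (k : Fin n) :
    negSimpleRootVector K k ∈ Symplectic.sp (Fin n) K := by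
  rw [mem_sp_iff]
  unfold negSimpleRootVector
  split_ifs with h
  · refine ⟨?_, ?_, ?_⟩ <;> ext i j <;>
      simp [Matrix.toBlocks₁₁, Matrix.toBlocks₁₂, Matrix.toBlocks₂₁, Matrix.toBlocks₂₂,
        Matrix.single_apply, and_comm]
  · refine ⟨?_, ?_, ?_⟩ <;> ext i j <;>
      simp [Matrix.toBlocks₁₁, Matrix.toBlocks₁₂, Matrix.toBlocks₂₁, Matrix.toBlocks₂₂,
        Matrix.single_apply, and_comm]

/-- `𝔤_{-α_{k+1}} ⊄ 𝔭` if and only if `α_{k+1} ∈ Ψ`. -/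
theorem negSimpleRootVector_mem_parabolic {Ψ : Set ℕ} (hΨ : Ψ ⊆ Set.Icc 1 n) (k : Fin n) :
    negSimpleRootVector K k ∈ parabolic K n Ψ ↔ (k : ℕ) + 1 ∉ Ψ := by
  have hk := k.isLt
  rw [mem_parabolic]
  constructor
  · rintro ⟨-, h⟩ hmem
    by_cases h1 : (k : ℕ) + 1 < n
    · have := h _ hmem (Sum.inl ⟨k + 1, h1⟩) (Sum.inl k) (by simp [pos]) (by simp [pos])
      simp [negSimpleRootVector, h1] at this
    · have := h _ hmem (Sum.inr k) (Sum.inl k) (by simp [pos]) (by simp only [pos]; omega)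
      simp [negSimpleRootVector, h1] at this
  · refine fun hk' => ⟨negSimpleRootVector_mem_sp k, fun m hm i j hj hi => ?_⟩
    have hmn := hΨ hm
    have hne : m ≠ k + 1 := fun h => hk' (h ▸ hm)
    simp only [Set.mem_Icc] at hmn
    unfold negSimpleRootVector
    split_ifs with h1
    · rw [Matrix.sub_apply, Matrix.single_apply_of_ne, Matrix.single_apply_of_ne, sub_zero]
      · rintro ⟨rfl, rfl⟩
        simp only [pos] at hi hj
        omega
      · rintro ⟨rfl, rfl⟩
        simp only [pos] at hi hj
        omega
    · rw [Matrix.single_apply_of_ne]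
      rintro ⟨rfl, rfl⟩
      simp only [pos] at hi hj
      omega

/-- `𝔤_{α_{k+1}} ⊄ 𝔭'` if and only if `α_{k+1} ∈ Ψ'`. -/
theorem simpleRootVector_mem_oppParabolic {Ψ : Set ℕ} (hΨ : Ψ ⊆ Set.Icc 1 n) (k : Fin n) :
    (negSimpleRootVector K k).transpose ∈ oppParabolic K n Ψ ↔ (k : ℕ) + 1 ∉ Ψ := by
  rw [← negSimpleRootVector_mem_parabolic (K := K) hΨ k, mem_parabolic, mem_oppParabolic]
  refine and_congr ?_ ?_
  · rw [iff_true_right (negSimpleRootVector_mem_sp k)]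
    have h := (mem_sp_iff _).mp (negSimpleRootVector_mem_sp (K := K) k)
    rw [mem_sp_iff]
    refine ⟨?_, ?_, ?_⟩
    · exact congrArg Matrix.transpose h.1
    · exact congrArg Matrix.transpose h.2.2
    · exact congrArg Matrix.transpose h.2.1
  · exact ⟨fun h m hm i j hj hi => h m hm j i hj hi, fun h m hm i j hi hj => h m hm j i hi hj⟩

end Seaweed

end SymplecticSeaweed

/-! Put V = Kⁿ, let U be the span of the first a basis vectors, W the span of the last r = n - c.
Because a + b = n, the seaweed preserves a Lagrangian subspace. It is therefore the semidirect
product of the common stabilizer of U and W in gl(V) with an abelian ideal, the symmetric tensors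
Sym²W.

The engine is `isFrob_semidirect`: a semidirect product of G with an abelian ideal M is Frobenius if
and only if some functional ξ on M has open G-orbit (stated infinitesimally: m ↦ (x ↦ ξ(x·m)) is
injective) and Frobenius stabilizer. For M = Sym²W, ξ is a symmetric form Q on W. Openness means
that Q is nondegenerate on W and on U ⊓ W (`open_iff_nondegOn`), and the stabilizer consists of the
A that preserve U and W and are skew on W (`stabFunctional_eq`).

This stabilizer is unravelled by the same engine. If U and W are disjoint it is a `quotExt`, and
`isFrob_quotExt` replaces the structure map by a map ξ of maximal rank in the opposite direction.
When ξ is surjective a smaller `quotExt` results, when it is injective a `subExt`. A `subExt`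
reduces either to a smaller `subExt` or again to the stabilizer of a pair of subspaces. In
dimensions this is the subtractive Euclidean algorithm for (n, b - r), with r fixed throughout
(`criterion_quotExt`, `criterion_subExt`). It stops when a quotient vanishes or when b < r. In the
latter case U + W = V, and the stabilizer is a product of so(b) with an algebra depending on dim U
and r - b (`isFrob_stab_of_codisjoint`). As so(d) is Frobenius only for d ≤ 1, only r ≤ 3 survives,
and r = 3 brings in a parity condition (`frobCond_of_lt`).

At each stage the answer depends on dimensions alone and not on the admissible ξ. So the existential
over ξ is settled by one computation, together with one witness in the cases where the numerical
condition holds. -/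

namespace SymplecticSeaweed

/-! ### Frobenius subspaces and semidirect products by an abelian ideal -/

section Frobenius

variable {K : Type*} [Field K]

/-- A subspace `S` of an associative algebra is Frobenius if some linear functional `f` makes the
form `f (x * y - y * x)` nondegenerate on `S`. -/
def IsFrob {R : Type*} [Ring R] [Algebra K R] (S : Submodule K R) : Prop :=
  ∃ f : R →ₗ[K] K, ∀ x ∈ S, (∀ y ∈ S, f (x * y - y * x) = 0) → x = 0

/-- Being closed under commutators. -/
def CommClosed {R : Type*} [Ring R] [Algebra K R] (S : Submodule K R) : Prop :=
  ∀ x ∈ S, ∀ y ∈ S, x * y - y * x ∈ S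

variable {R R' : Type*} [Ring R] [Algebra K R] [Ring R'] [Algebra K R']

/-- Functionals can be carried along a map that is injective on `S` only, which is all that the
ambient algebras offer below. -/
theorem exists_extend_of_injOn {V V' : Type*} [AddCommGroup V] [Module K V] [AddCommGroup V']
    [Module K V'] (S : Submodule K V) (T : V →ₗ[K] V') (hT : ∀ x ∈ S, T x = 0 → x = 0)
    (f : V →ₗ[K] K) : ∃ g : V' →ₗ[K] K, ∀ x ∈ S, g (T x) = f x := by
  have hinj : LinearMap.ker (T ∘ₗ S.subtype) = ⊥ := by
    rw [LinearMap.ker_eq_bot']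
    intro x hx
    exact Subtype.ext (hT x x.2 hx)
  obtain ⟨g, hg⟩ := (T ∘ₗ S.subtype).exists_leftInverse_of_injective hinj
  refine ⟨f ∘ₗ S.subtype ∘ₗ g, fun x hx => ?_⟩
  have := LinearMap.congr_fun hg ⟨x, hx⟩
  simp only [LinearMap.comp_apply, Submodule.subtype_apply, LinearMap.id_apply] at this ⊢
  rw [this]

/-- Transport along a linear map inducing a bijection that respects commutators. -/
theorem isFrob_congr {S : Submodule K R} {S' : Submodule K R'} (hS : CommClosed S)
    (T : R →ₗ[K] R') (hmap : ∀ x ∈ S, T x ∈ S') (hinj : ∀ x ∈ S, T x = 0 → x = 0)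
    (hsurj : ∀ y ∈ S', ∃ x ∈ S, T x = y)
    (hcomm : ∀ x ∈ S, ∀ y ∈ S, T (x * y - y * x) = T x * T y - T y * T x) :
    IsFrob S ↔ IsFrob S' := by
  constructor
  · rintro ⟨f, hf⟩
    obtain ⟨g, hg⟩ := exists_extend_of_injOn S T hinj f
    refine ⟨g, fun x' hx' h => ?_⟩
    obtain ⟨x, hx, rfl⟩ := hsurj x' hx'
    rw [hf x hx fun y hy => ?_, map_zero]
    rw [← hg _ (hS x hx y hy), hcomm x hx y hy]
    exact h _ (hmap y hy)
  · rintro ⟨f, hf⟩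
    refine ⟨f ∘ₗ T, fun x hx h => hinj x hx (hf _ (hmap x hx) fun y' hy' => ?_)⟩
    obtain ⟨y, hy, rfl⟩ := hsurj y' hy'
    rw [← hcomm x hx y hy]
    exact h y hy

theorem isFrob_prod {S : Submodule K R} {S' : Submodule K R'} :
    IsFrob (S.prod S') ↔ IsFrob S ∧ IsFrob S' := by
  constructor
  · rintro ⟨f, hf⟩
    refine ⟨⟨f ∘ₗ LinearMap.inl K R R', fun x hx h => ?_⟩,
      ⟨f ∘ₗ LinearMap.inr K R R', fun x hx h => ?_⟩⟩
    · have := hf (x, 0) ⟨hx, S'.zero_mem⟩ fun y hy => by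
        have e : (x, 0) * y - y * (x, 0) = ((x * y.1 - y.1 * x, 0) : R × R') := by ext <;> simp
        rw [e]
        exact h y.1 hy.1
      exact congrArg Prod.fst this
    · have := hf (0, x) ⟨S.zero_mem, hx⟩ fun y hy => by
        have e : (0, x) * y - y * (0, x) = ((0, x * y.2 - y.2 * x) : R × R') := by ext <;> simp
        rw [e]
        exact h y.2 hy.2
      exact congrArg Prod.snd this
  · rintro ⟨⟨f, hf⟩, g, hg⟩
    refine ⟨f.coprod g, fun x hx h => Prod.ext (hf x.1 hx.1 fun y hy => ?_)
      (hg x.2 hx.2 fun y hy => ?_)⟩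
    · simpa using h (y, 0) ⟨hy, S'.zero_mem⟩
    · simpa using h (0, y) ⟨S.zero_mem, hy⟩

theorem not_isFrob_of_central {S : Submodule K R} {z : R} (hz : z ∈ S) (hz0 : z ≠ 0)
    (hc : ∀ y ∈ S, z * y = y * z) : ¬ IsFrob S := by
  rintro ⟨f, hf⟩
  exact hz0 (hf z hz fun y hy => by rw [hc y hy, sub_self, map_zero])

/-- The stabilizer in `G` of a functional `ξ` on `M`. -/
def stabFunctional {M : Type*} [AddCommGroup M] [Module K M] (G : Submodule K R)
    (act : R →ₗ[K] M →ₗ[K] M) (ξ : M →ₗ[K] K) : Submodule K R where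
  carrier := {x | x ∈ G ∧ ∀ m, ξ (act x m) = 0}
  add_mem' := fun hx hy => ⟨G.add_mem hx.1 hy.1, fun m => by
    rw [map_add, LinearMap.add_apply, map_add, hx.2, hy.2, add_zero]⟩
  zero_mem' := ⟨G.zero_mem, fun m => by simp⟩
  smul_mem' := fun t x hx => ⟨G.smul_mem t hx.1, fun m => by
    rw [map_smul, LinearMap.smul_apply, map_smul, hx.2, smul_zero]⟩

theorem mem_stabFunctional {M : Type*} [AddCommGroup M] [Module K M] {G : Submodule K R}
    {act : R →ₗ[K] M →ₗ[K] M} {ξ : M →ₗ[K] K} {x : R} :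
    x ∈ stabFunctional G act ξ ↔ x ∈ G ∧ ∀ m, ξ (act x m) = 0 := Iff.rfl

/-- In a finite-dimensional space, a functional vanishing on the common kernel of a linear family
of functionals belongs to the family. -/
theorem exists_eq_of_vanish {M G : Type*} [AddCommGroup M] [Module K M] [AddCommGroup G]
    [Module K G] [FiniteDimensional K G] (Φ : M →ₗ[K] Module.Dual K G) (ψ : Module.Dual K G)
    (h : ∀ y, (∀ m, Φ m y = 0) → ψ y = 0) : ∃ m, Φ m = ψ := by
  have : ψ ∈ (LinearMap.range Φ).dualCoannihilator.dualAnnihilator := by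
    rw [Submodule.mem_dualAnnihilator]
    intro y hy
    rw [Submodule.mem_dualCoannihilator] at hy
    exact h y fun m => hy _ ⟨m, rfl⟩
  rw [Subspace.dualCoannihilator_dualAnnihilator_eq] at this
  exact this

/-- The reduction for semidirect products by an abelian ideal. -/
theorem isFrob_semidirect [FiniteDimensional K R'] {M : Type*} [AddCommGroup M] [Module K M]
    {S : Submodule K R} {G : Submodule K R'} (ι : R' →ₗ[K] R) (κ : M →ₗ[K] R)
    (act : R' →ₗ[K] M →ₗ[K] M) (hG : CommClosed G)
    (hι : ∀ x ∈ G, ι x ∈ S) (hκ : ∀ m, κ m ∈ S)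
    (hdec : ∀ s ∈ S, ∃ x ∈ G, ∃ m, s = ι x + κ m)
    (huniq : ∀ x ∈ G, ∀ m, ι x + κ m = 0 → x = 0 ∧ m = 0)
    (hιι : ∀ x ∈ G, ∀ y ∈ G, ι x * ι y - ι y * ι x = ι (x * y - y * x))
    (hικ : ∀ x ∈ G, ∀ m, ι x * κ m - κ m * ι x = κ (act x m))
    (hκκ : ∀ m m', κ m * κ m' - κ m' * κ m = 0) :
    IsFrob S ↔ ∃ ξ : M →ₗ[K] K, (∀ m, (∀ x ∈ G, ξ (act x m) = 0) → m = 0) ∧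
      IsFrob (stabFunctional G act ξ) := by
  have hbr : ∀ x ∈ G, ∀ y ∈ G, ∀ m m', (ι x + κ m) * (ι y + κ m') - (ι y + κ m') * (ι x + κ m)
      = ι (x * y - y * x) + κ (act x m') - κ (act y m) := by
    intro x hx y hy m m'
    have h1 := hιι x hx y hy
    have h2 := hικ x hx m'
    have h3 := hικ y hy m
    have h4 := hκκ m m'
    rw [← h1, ← h2, ← h3]
    calc _ = (ι x * ι y - ι y * ι x) + (ι x * κ m' - κ m' * ι x) - (ι y * κ m - κ m * ι y)
          + (κ m * κ m' - κ m' * κ m) := by noncomm_ring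
      _ = _ := by rw [h4, add_zero]
  constructor
  · rintro ⟨f, hf⟩
    refine ⟨f ∘ₗ κ, fun m hm => ?_, f ∘ₗ ι, fun x hx h => ?_⟩
    · have h0 : κ m = 0 := hf _ (hκ m) fun s hs => by
        obtain ⟨y, hy, m', rfl⟩ := hdec s hs
        have := hbr 0 G.zero_mem y hy m m'
        simp only [map_zero, zero_add, zero_mul, mul_zero, sub_zero, LinearMap.zero_apply] at this
        rw [this, map_sub, map_zero, zero_sub, neg_eq_zero]
        exact hm y hy
      exact (huniq 0 G.zero_mem m (by rw [h0, map_zero, add_zero])).2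
    · obtain ⟨hxG, hxm⟩ := hx
      let Φ : M →ₗ[K] Module.Dual K G :=
        (LinearMap.mk₂ K (fun m (y : G) => f (κ (act y m)))
          (by intros; simp) (by intros; simp) (by intros; simp) (by intros; simp))
      let ψ : Module.Dual K G :=
        { toFun := fun y => f (ι (x * y - y * x))
          map_add' := fun y z => by
            rw [← map_add, ← map_add]; congr 2; push_cast; noncomm_ring
          map_smul' := fun t y => by
            simp only [Submodule.coe_smul, mul_smul_comm, smul_mul_assoc, ← smul_sub, map_smul,
              RingHom.id_apply] }
      -- An element y annihilated by all functionals y ↦ f(y·m) lies in the stabilizer, where `h`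
      -- applies. Hence f([x, ·]) on G is y ↦ f(y·m) for some m, and x + m lies in the radical of
      -- the form.
      obtain ⟨m, hm⟩ := exists_eq_of_vanish Φ ψ fun y hy => h y ⟨y.2, hy⟩
      have h0 : ι x + κ m = 0 := hf _ (S.add_mem (hι x hxG) (hκ m)) fun s hs => by
        obtain ⟨y, hy, m', rfl⟩ := hdec s hs
        rw [hbr x hxG y hy m m', map_sub, map_add]
        have h1 : f (κ (act y m)) = f (ι (x * y - y * x)) := LinearMap.congr_fun hm ⟨y, hy⟩
        have h2 : f (κ (act x m')) = 0 := hxm m'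
        rw [h1, h2, add_zero, sub_self]
      exact (huniq x hxG m h0).1
  · rintro ⟨ξ, hξ, g, hg⟩
    obtain ⟨f, hf⟩ := exists_extend_of_injOn (G.prod ⊤) (ι.coprod κ)
      (fun p hp h => by
        have := huniq p.1 hp.1 p.2 (by simpa using h)
        exact Prod.ext this.1 this.2) (g.coprod ξ)
    have hfι : ∀ x ∈ G, f (ι x) = g x := fun x hx => by
      simpa using hf (x, 0) ⟨hx, trivial⟩
    have hfκ : ∀ m, f (κ m) = ξ m := fun m => by
      simpa using hf (0, m) ⟨G.zero_mem, trivial⟩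
    refine ⟨f, fun s hs h => ?_⟩
    obtain ⟨x, hx, m, rfl⟩ := hdec s hs
    have key : ∀ y ∈ G, ∀ m', g (x * y - y * x) + ξ (act x m') - ξ (act y m) = 0 := by
      intro y hy m'
      rw [← h _ (S.add_mem (hι y hy) (hκ m')), hbr x hx y hy m m', map_sub f, map_add f,
        hfι _ (hG x hx y hy), hfκ, hfκ]
    -- Pairing with M puts x in the stabilizer. Pairing with the stabilizer, where the term in m
    -- drops out, gives x = 0. Openness then gives m = 0.
    have hxs : ∀ m', ξ (act x m') = 0 := fun m' => by simpa using key 0 G.zero_mem m'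
    have hx0 : x = 0 := hg x ⟨hx, hxs⟩ fun y hy => by
      have := key y hy.1 0
      rwa [hy.2, sub_zero, map_zero, map_zero, add_zero] at this
    subst hx0
    have hm0 : m = 0 := hξ m fun y hy => by simpa using key y hy 0
    rw [hm0, map_zero, map_zero, add_zero]

end Frobenius

/-! ### The trace pairing between Hom(X, Y) and Hom(Y, X) -/

section Trace

variable {K : Type*} [Field K] {X Y : Type*} [AddCommGroup X] [Module K X]
  [AddCommGroup Y] [Module K Y] [FiniteDimensional K Y]

theorem trace_comp_smulRight (ξ : X →ₗ[K] Y) (l : Y →ₗ[K] K) (x : X) :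
    LinearMap.trace K Y (ξ ∘ₗ l.smulRight x) = l (ξ x) := by
  have e : ξ ∘ₗ l.smulRight x = l.smulRight (ξ x) := by ext y; simp
  rw [e, LinearMap.trace_smulRight]

theorem eq_zero_of_forall_dual {y : Y} (h : ∀ l : Y →ₗ[K] K, l y = 0) : y = 0 :=
  (Module.forall_dual_apply_eq_zero_iff K y).mp h

theorem eq_zero_of_trace_comp (ξ : X →ₗ[K] Y)
    (h : ∀ φ : Y →ₗ[K] X, LinearMap.trace K Y (ξ ∘ₗ φ) = 0) : ξ = 0 := by
  ext x
  refine eq_zero_of_forall_dual (K := K) fun l => ?_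
  rw [← trace_comp_smulRight, h]

/-- Functionals on the abelian ideals Hom(Y, X) below thereby become linear maps ξ in the opposite
direction. -/
theorem exists_eq_trace_comp [FiniteDimensional K X] (f : (Y →ₗ[K] X) →ₗ[K] K) :
    ∃ ξ : X →ₗ[K] Y, ∀ φ, f φ = LinearMap.trace K Y (ξ ∘ₗ φ) := by
  let Φ : (X →ₗ[K] Y) →ₗ[K] Module.Dual K (Y →ₗ[K] X) :=
    LinearMap.mk₂ K (fun ξ φ => LinearMap.trace K Y (ξ ∘ₗ φ))
      (by intros; simp [LinearMap.add_comp]) (by intros; simp [LinearMap.smul_comp])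
      (by intros; simp [LinearMap.comp_add]) (by intros; simp [LinearMap.comp_smul])
  obtain ⟨ξ, hξ⟩ := exists_eq_of_vanish Φ f fun φ hφ => by
    rw [eq_zero_of_trace_comp φ fun ξ => by rw [LinearMap.trace_comp_comm']; exact hφ ξ, map_zero]
  exact ⟨ξ, fun φ => by rw [← hξ]; rfl⟩

end Trace

/-! ### Extensions along a quotient map or an inclusion, and one reduction step for each -/

section Extensions

variable {K : Type*} [Field K] {R : Type*} [Ring R] [Algebra K R]
  {V X Y : Type*} [AddCommGroup V] [Module K V] [AddCommGroup X] [Module K X]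
  [AddCommGroup Y] [Module K Y]

/-- Pairs of `x ∈ h` and an endomorphism of `V` inducing `ρ x` along `π : V → Y`. -/
def quotExt (h : Submodule K R) (ρ : R →ₗ[K] Module.End K Y) (π : V →ₗ[K] Y) :
    Submodule K (R × Module.End K V) where
  carrier := {p | p.1 ∈ h ∧ ∀ v, π (p.2 v) = ρ p.1 (π v)}
  add_mem' := fun hx hy => ⟨h.add_mem hx.1 hy.1, fun v => by simp [hx.2, hy.2]⟩
  zero_mem' := ⟨h.zero_mem, fun v => by simp⟩
  smul_mem' := fun t x hx => ⟨h.smul_mem t hx.1, fun v => by simp [hx.2]⟩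

theorem mem_quotExt {h : Submodule K R} {ρ : R →ₗ[K] Module.End K Y} {π : V →ₗ[K] Y}
    {p : R × Module.End K V} :
    p ∈ quotExt h ρ π ↔ p.1 ∈ h ∧ ∀ v, π (p.2 v) = ρ p.1 (π v) := Iff.rfl

/-- Pairs of `x ∈ h` and an endomorphism of `V` restricting to `x` along `i : X → V`. -/
def subExt (h : Submodule K (Module.End K X)) (i : X →ₗ[K] V) :
    Submodule K (Module.End K X × Module.End K V) where
  carrier := {p | p.1 ∈ h ∧ ∀ v, p.2 (i v) = i (p.1 v)}
  add_mem' := fun hx hy => ⟨h.add_mem hx.1 hy.1, fun v => by simp [hx.2, hy.2]⟩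
  zero_mem' := ⟨h.zero_mem, fun v => by simp⟩
  smul_mem' := fun t x hx => ⟨h.smul_mem t hx.1, fun v => by simp [hx.2]⟩

theorem mem_subExt {h : Submodule K (Module.End K X)} {i : X →ₗ[K] V}
    {p : Module.End K X × Module.End K V} :
    p ∈ subExt h i ↔ p.1 ∈ h ∧ ∀ v, p.2 (i v) = i (p.1 v) := Iff.rfl

theorem commClosed_quotExt {h : Submodule K R} {ρ : R →ₗ[K] Module.End K Y} {π : V →ₗ[K] Y}
    (hh : CommClosed h)
    (hρ : ∀ x ∈ h, ∀ y ∈ h, ρ (x * y - y * x) = ρ x * ρ y - ρ y * ρ x) :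
    CommClosed (quotExt h ρ π) := fun x hx y hy =>
  ⟨hh _ hx.1 _ hy.1, fun v => by
    simp only [Prod.snd_sub, Prod.snd_mul, Prod.fst_sub, Prod.fst_mul]
    rw [hρ _ hx.1 _ hy.1]
    simp [hx.2, hy.2]⟩

theorem commClosed_subExt {h : Submodule K (Module.End K X)} {i : X →ₗ[K] V}
    (hh : CommClosed h) : CommClosed (subExt h i) := fun x hx y hy =>
  ⟨hh _ hx.1 _ hy.1, fun v => by simp [hx.2, hy.2]⟩

theorem commClosed_prod {R' : Type*} [Ring R'] [Algebra K R'] {S : Submodule K R}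
    {S' : Submodule K R'} (hS : CommClosed S) (hS' : CommClosed S') :
    CommClosed (S.prod S') := fun _ hx _ hy => ⟨hS _ hx.1 _ hy.1, hS' _ hx.2 _ hy.2⟩

theorem commClosed_top : CommClosed (⊤ : Submodule K R) := fun _ _ _ _ => trivial

/-- With N = ker π, a section of π splits the extension into h × gl(N) acting on the abelian ideal
Hom(Y, N). The stabilizer of a functional ξ : N → Y is an extension of the same kind, with N in
place of V. In the openness condition the equation φ ∘ ξ = 0 comes from gl(N), and the trace
condition from h. -/
theorem isFrob_quotExt [FiniteDimensional K R] [FiniteDimensional K V] [FiniteDimensional K Y]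
    {h : Submodule K R} {ρ : R →ₗ[K] Module.End K Y} {π : V →ₗ[K] Y} (hh : CommClosed h)
    (hρ : ∀ x ∈ h, ∀ y ∈ h, ρ (x * y - y * x) = ρ x * ρ y - ρ y * ρ x)
    (hπ : Function.Surjective π) :
    IsFrob (quotExt h ρ π) ↔ ∃ ξ : LinearMap.ker π →ₗ[K] Y,
      (∀ φ : Y →ₗ[K] LinearMap.ker π, φ ∘ₗ ξ = 0 →
        (∀ x ∈ h, LinearMap.trace K Y (ξ ∘ₗ φ ∘ₗ ρ x) = 0) → φ = 0) ∧
      IsFrob (quotExt h ρ ξ) := by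
  obtain ⟨s, hs⟩ := π.exists_rightInverse_of_surjective (LinearMap.range_eq_top.mpr hπ)
  replace hs : ∀ y, π (s y) = y := fun y => LinearMap.congr_fun hs y
  let N := LinearMap.ker π
  have hN : ∀ n : N, π n = 0 := fun n => n.2
  let pN : V →ₗ[K] N := (LinearMap.id - s ∘ₗ π).codRestrict N fun v => by
    simp [N, hs]
  have hpN : ∀ v, (pN v : V) = v - s (π v) := fun v => rfl
  have hpNn : ∀ n : N, pN n = n := fun n => Subtype.ext (by rw [hpN, hN, map_zero, sub_zero])
  have hpNs : ∀ y, pN (s y) = 0 := fun y => Subtype.ext (by rw [hpN, hs, sub_self]; rfl)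
  let ι : R × Module.End K N →ₗ[K] R × Module.End K V :=
    { toFun := fun p => (p.1, N.subtype ∘ₗ p.2 ∘ₗ pN + s ∘ₗ ρ p.1 ∘ₗ π)
      map_add' := fun p q => by
        refine Prod.ext rfl (LinearMap.ext fun v => ?_)
        simp only [Prod.fst_add, Prod.snd_add, map_add, LinearMap.add_apply, LinearMap.comp_apply]
        abel
      map_smul' := fun t p => by
        refine Prod.ext rfl (LinearMap.ext fun v => ?_)
        simp }
  have hι2 : ∀ p v, (ι p).2 v = (p.2 (pN v) : V) + s (ρ p.1 (π v)) := fun p v => rfl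
  let κ : (Y →ₗ[K] N) →ₗ[K] R × Module.End K V :=
    { toFun := fun φ => (0, N.subtype ∘ₗ φ ∘ₗ π)
      map_add' := fun p q => by
        refine Prod.ext (by simp) (LinearMap.ext fun v => ?_)
        simp
      map_smul' := fun t p => by
        refine Prod.ext (by simp) (LinearMap.ext fun v => ?_)
        simp }
  have hκ2 : ∀ φ v, (κ φ).2 v = (φ (π v) : V) := fun φ v => rfl
  let act : R × Module.End K N →ₗ[K] (Y →ₗ[K] N) →ₗ[K] (Y →ₗ[K] N) :=
    LinearMap.mk₂ K (fun p φ => p.2 ∘ₗ φ - φ ∘ₗ ρ p.1)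
      (by intros; ext; simp; abel) (by intros; ext; simp [smul_sub])
      (by intros; ext; simp; abel) (by intros; ext; simp [smul_sub])
  have hact : ∀ p φ, act p φ = p.2 ∘ₗ φ - φ ∘ₗ ρ p.1 := fun p φ => rfl
  rw [isFrob_semidirect (S := quotExt h ρ π) (G := h.prod ⊤) ι κ act
    (commClosed_prod hh commClosed_top)]
  -- By cyclicity of the trace, the functional sees a pair (x, A) only through its failure ξ ∘ A - ρ
  -- x ∘ ξ to intertwine along ξ.
  · have htr : ∀ (ξ : N →ₗ[K] Y) p φ, LinearMap.trace K Y (ξ ∘ₗ act p φ) =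
        LinearMap.trace K Y ((ξ ∘ₗ p.2 - ρ p.1 ∘ₗ ξ) ∘ₗ φ) := by
      intro ξ p φ
      rw [hact, LinearMap.comp_sub, LinearMap.sub_comp, map_sub, map_sub, LinearMap.comp_assoc]
      congr 1
      rw [← LinearMap.comp_assoc, LinearMap.trace_comp_comm', LinearMap.comp_assoc]
    have hst : ∀ (ξ : N →ₗ[K] Y) (f : (Y →ₗ[K] N) →ₗ[K] K),
        (∀ φ, f φ = LinearMap.trace K Y (ξ ∘ₗ φ)) →
        stabFunctional (h.prod ⊤) act f = quotExt h ρ ξ := by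
      intro ξ f hf
      ext p
      rw [mem_stabFunctional, mem_quotExt]
      constructor
      · rintro ⟨h1, h2⟩
        refine ⟨h1.1, fun v => ?_⟩
        have := eq_zero_of_trace_comp (ξ ∘ₗ p.2 - ρ p.1 ∘ₗ ξ) fun φ => by
          rw [← htr, ← hf, h2]
        exact sub_eq_zero.mp (LinearMap.congr_fun this v)
      · rintro ⟨h1, h2⟩
        refine ⟨⟨h1, trivial⟩, fun φ => ?_⟩
        have : ξ ∘ₗ p.2 - ρ p.1 ∘ₗ ξ = 0 := by
          ext v; exact sub_eq_zero.mpr (h2 v)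
        rw [hf, htr, this, LinearMap.zero_comp, map_zero]
    have hop : ∀ (ξ : N →ₗ[K] Y) (f : (Y →ₗ[K] N) →ₗ[K] K),
        (∀ φ, f φ = LinearMap.trace K Y (ξ ∘ₗ φ)) → ∀ φ,
        ((∀ p ∈ h.prod ⊤, f (act p φ) = 0) ↔
          φ ∘ₗ ξ = 0 ∧ ∀ x ∈ h, LinearMap.trace K Y (ξ ∘ₗ φ ∘ₗ ρ x) = 0) := by
      intro ξ f hf φ
      constructor
      · intro H
        refine ⟨eq_zero_of_trace_comp _ fun α => ?_, fun x hx => ?_⟩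
        · have := H (0, α) ⟨h.zero_mem, trivial⟩
          rw [hf, hact] at this
          rw [LinearMap.comp_assoc, LinearMap.trace_comp_comm', LinearMap.comp_assoc]
          simpa using this
        · have := H (x, 0) ⟨hx, trivial⟩
          rw [hf, hact] at this
          simpa using this
      · rintro ⟨h1, h2⟩ p hp
        rw [hf, hact, LinearMap.comp_sub, map_sub, h2 _ hp.1, sub_zero, ← LinearMap.comp_assoc,
          LinearMap.trace_comp_comm', ← LinearMap.comp_assoc, h1, LinearMap.zero_comp, map_zero]
    constructor
    · rintro ⟨f, h1, h2⟩
      obtain ⟨ξ, hξ⟩ := exists_eq_trace_comp f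
      refine ⟨ξ, fun φ a b => h1 φ ((hop ξ f hξ φ).mpr ⟨a, b⟩), ?_⟩
      rwa [hst ξ f hξ] at h2
    · rintro ⟨ξ, h1, h2⟩
      let f : (Y →ₗ[K] N) →ₗ[K] K :=
        { toFun := fun φ => LinearMap.trace K Y (ξ ∘ₗ φ)
          map_add' := fun a b => by rw [LinearMap.comp_add, map_add]
          map_smul' := fun a b => by rw [LinearMap.comp_smul, map_smul]; rfl }
      refine ⟨f, fun φ a => ?_, ?_⟩
      · obtain ⟨a1, a2⟩ := (hop ξ f (fun _ => rfl) φ).mp a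
        exact h1 φ a1 a2
      · rwa [hst ξ f fun _ => rfl]
  · intro p hp
    exact ⟨hp.1, fun v => by rw [hι2, map_add, hN, hs, zero_add]; rfl⟩
  · intro φ
    exact ⟨h.zero_mem, fun v => by rw [hκ2, hN]; simp [κ]⟩
  · rintro ⟨x, A⟩ ⟨hx, hA⟩
    simp only at hx hA
    have hAN : ∀ n : N, A n ∈ N := fun n => by
      rw [LinearMap.mem_ker, hA, hN, map_zero]
    have hAs : ∀ y, A (s y) - s (ρ x y) ∈ N := fun y => by
      rw [LinearMap.mem_ker, map_sub, hA, hs, hs, sub_self]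
    refine ⟨(x, (A ∘ₗ N.subtype).codRestrict N hAN), ⟨hx, trivial⟩,
      (A ∘ₗ s - s ∘ₗ ρ x).codRestrict N hAs, ?_⟩
    refine Prod.ext ?_ (LinearMap.ext fun v => ?_)
    · simp [ι, κ]
    · rw [Prod.snd_add, LinearMap.add_apply, hι2, hκ2]
      change A v = A (pN v : V) + s (ρ x (π v)) + (A (s (π v)) - s (ρ x (π v)))
      rw [hpN, map_sub]
      abel
  · intro p hp φ h0
    have h1 : p.1 = 0 := by simpa [ι, κ] using congrArg Prod.fst h0
    have h2 : ∀ v, (p.2 (pN v) : V) + s (ρ p.1 (π v)) + φ (π v) = 0 := fun v => by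
      have := LinearMap.congr_fun (congrArg Prod.snd h0) v
      rwa [Prod.snd_add, LinearMap.add_apply, hι2, hκ2] at this
    refine ⟨Prod.ext h1 (LinearMap.ext fun n => Subtype.ext ?_),
      LinearMap.ext fun y => Subtype.ext ?_⟩
    · simpa [hpNn, hN] using h2 n
    · simpa [hpNs, hs, h1] using h2 (s y)
  · intro p hp q hq
    have hρ' : ρ (p * q - q * p).1 = ρ p.1 * ρ q.1 - ρ q.1 * ρ p.1 := hρ _ hp.1 _ hq.1
    refine Prod.ext rfl (LinearMap.ext fun v => ?_)
    rw [hι2 (p * q - q * p), hρ']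
    simp only [Prod.snd_sub, Prod.snd_mul, LinearMap.sub_apply, Module.End.mul_apply, hι2,
      map_add, hpNn, hpNs, hN, hs, zero_add, add_zero, map_sub, Submodule.coe_sub]
    abel
  · intro p hp φ
    refine Prod.ext (by simp [ι, κ]) (LinearMap.ext fun v => ?_)
    simp only [Prod.snd_sub, Prod.snd_mul, LinearMap.sub_apply, Module.End.mul_apply, hι2, hκ2,
      map_add, hpNn, hN, hs, map_zero, zero_add, add_zero, hact, LinearMap.comp_apply,
      Submodule.coe_sub]
  · intro φ φ'
    refine Prod.ext (by simp [κ]) (LinearMap.ext fun v => ?_)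
    simp [hκ2, hN]

/-- Dual to `isFrob_quotExt`: the retraction q supplies the complement C = ker q of X, the abelian
ideal is Hom(C, X), and the stabilizer of ξ : X → C is a `subExt` with C in place of V. -/
theorem isFrob_subExt [FiniteDimensional K X] [FiniteDimensional K V]
    {h : Submodule K (Module.End K X)} (hh : CommClosed h) {i : X →ₗ[K] V} {q : V →ₗ[K] X}
    (hq : ∀ x, q (i x) = x) :
    IsFrob (subExt h i) ↔ ∃ ξ : X →ₗ[K] LinearMap.ker q,
      (∀ φ : LinearMap.ker q →ₗ[K] X, ξ ∘ₗ φ = 0 →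
        (∀ x ∈ h, LinearMap.trace K X (φ ∘ₗ ξ ∘ₗ x) = 0) → φ = 0) ∧
      IsFrob (subExt h ξ) := by
  let C := LinearMap.ker q
  have hC : ∀ c : C, q c = 0 := fun c => c.2
  let pC : V →ₗ[K] C := (LinearMap.id - i ∘ₗ q).codRestrict C fun v => by
    simp [C, hq]
  have hpC : ∀ v, (pC v : V) = v - i (q v) := fun v => rfl
  have hpCc : ∀ c : C, pC c = c := fun c => Subtype.ext (by rw [hpC, hC, map_zero, sub_zero])
  have hpCi : ∀ x, pC (i x) = 0 := fun y => Subtype.ext (by rw [hpC, hq, sub_self]; rfl)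
  let ι : Module.End K X × Module.End K C →ₗ[K] Module.End K X × Module.End K V :=
    { toFun := fun p => (p.1, C.subtype ∘ₗ p.2 ∘ₗ pC + i ∘ₗ p.1 ∘ₗ q)
      map_add' := fun p q => by
        refine Prod.ext rfl (LinearMap.ext fun v => ?_)
        simp only [Prod.fst_add, Prod.snd_add, map_add, LinearMap.add_apply, LinearMap.comp_apply]
        abel
      map_smul' := fun t p => by
        refine Prod.ext rfl (LinearMap.ext fun v => ?_)
        simp }
  have hι2 : ∀ p v, (ι p).2 v = (p.2 (pC v) : V) + i (p.1 (q v)) := fun p v => rfl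
  let κ : (C →ₗ[K] X) →ₗ[K] Module.End K X × Module.End K V :=
    { toFun := fun φ => (0, i ∘ₗ φ ∘ₗ pC)
      map_add' := fun p q => by
        refine Prod.ext (by simp) (LinearMap.ext fun v => ?_)
        simp
      map_smul' := fun t p => by
        refine Prod.ext (by simp) (LinearMap.ext fun v => ?_)
        simp }
  have hκ2 : ∀ φ v, (κ φ).2 v = i (φ (pC v)) := fun φ v => rfl
  let act : Module.End K X × Module.End K C →ₗ[K] (C →ₗ[K] X) →ₗ[K] (C →ₗ[K] X) :=
    LinearMap.mk₂ K (fun p φ => p.1 ∘ₗ φ - φ ∘ₗ p.2)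
      (by intros; ext; simp; abel) (by intros; ext; simp [smul_sub])
      (by intros; ext; simp; abel) (by intros; ext; simp [smul_sub])
  have hact : ∀ p φ, act p φ = p.1 ∘ₗ φ - φ ∘ₗ p.2 := fun p φ => rfl
  rw [isFrob_semidirect (S := subExt h i) (G := h.prod ⊤) ι κ act
    (commClosed_prod hh commClosed_top)]
  · have htr : ∀ (ξ : X →ₗ[K] C) p φ, LinearMap.trace K C (ξ ∘ₗ act p φ) =
        LinearMap.trace K C ((ξ ∘ₗ p.1 - p.2 ∘ₗ ξ) ∘ₗ φ) := by
      intro ξ p φ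
      rw [hact, LinearMap.comp_sub, LinearMap.sub_comp, map_sub, map_sub, LinearMap.comp_assoc]
      congr 1
      rw [← LinearMap.comp_assoc, LinearMap.trace_comp_comm', LinearMap.comp_assoc]
    have hst : ∀ (ξ : X →ₗ[K] C) (f : (C →ₗ[K] X) →ₗ[K] K),
        (∀ φ, f φ = LinearMap.trace K C (ξ ∘ₗ φ)) →
        stabFunctional (h.prod ⊤) act f = subExt h ξ := by
      intro ξ f hf
      ext p
      rw [mem_stabFunctional, mem_subExt]
      constructor
      · rintro ⟨h1, h2⟩
        refine ⟨h1.1, fun v => ?_⟩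
        have := eq_zero_of_trace_comp (ξ ∘ₗ p.1 - p.2 ∘ₗ ξ) fun φ => by
          rw [← htr, ← hf, h2]
        exact (sub_eq_zero.mp (LinearMap.congr_fun this v)).symm
      · rintro ⟨h1, h2⟩
        refine ⟨⟨h1, trivial⟩, fun φ => ?_⟩
        have : ξ ∘ₗ p.1 - p.2 ∘ₗ ξ = 0 := by
          ext1 v; exact sub_eq_zero.mpr (h2 v).symm
        rw [hf, htr, this, LinearMap.zero_comp, map_zero]
    have hop : ∀ (ξ : X →ₗ[K] C) (f : (C →ₗ[K] X) →ₗ[K] K),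
        (∀ φ, f φ = LinearMap.trace K C (ξ ∘ₗ φ)) → ∀ φ,
        ((∀ p ∈ h.prod ⊤, f (act p φ) = 0) ↔
          ξ ∘ₗ φ = 0 ∧ ∀ x ∈ h, LinearMap.trace K X (φ ∘ₗ ξ ∘ₗ x) = 0) := by
      intro ξ f hf φ
      constructor
      · intro H
        refine ⟨eq_zero_of_trace_comp _ fun α => ?_, fun x hx => ?_⟩
        · have := H (0, α) ⟨h.zero_mem, trivial⟩
          rw [hf, hact] at this
          rw [LinearMap.comp_assoc]
          simpa using this
        · have := H (x, 0) ⟨hx, trivial⟩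
          rw [hf, hact] at this
          rw [LinearMap.trace_comp_comm', LinearMap.comp_assoc]
          simpa using this
      · rintro ⟨h1, h2⟩ p hp
        rw [hf, hact, LinearMap.comp_sub, map_sub, ← LinearMap.comp_assoc, ← LinearMap.comp_assoc,
          h1, LinearMap.zero_comp, map_zero, sub_zero, LinearMap.trace_comp_comm', h2 _ hp.1]
    constructor
    · rintro ⟨f, h1, h2⟩
      obtain ⟨ξ, hξ⟩ := exists_eq_trace_comp f
      refine ⟨ξ, fun φ a b => h1 φ ((hop ξ f hξ φ).mpr ⟨a, b⟩), ?_⟩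
      rwa [hst ξ f hξ] at h2
    · rintro ⟨ξ, h1, h2⟩
      let f : (C →ₗ[K] X) →ₗ[K] K :=
        { toFun := fun φ => LinearMap.trace K C (ξ ∘ₗ φ)
          map_add' := fun a b => by rw [LinearMap.comp_add, map_add]
          map_smul' := fun a b => by rw [LinearMap.comp_smul, map_smul]; rfl }
      refine ⟨f, fun φ a => ?_, ?_⟩
      · obtain ⟨a1, a2⟩ := (hop ξ f (fun _ => rfl) φ).mp a
        exact h1 φ a1 a2
      · rwa [hst ξ f fun _ => rfl]
  · intro p hp
    exact ⟨hp.1, fun v => by rw [hι2, hpCi, hq, map_zero]; simp [ι]⟩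
  · intro φ
    exact ⟨h.zero_mem, fun v => by rw [hκ2, hpCi]; simp [κ]⟩
  · rintro ⟨x, A⟩ ⟨hx, hA⟩
    simp only at hx hA
    refine ⟨(x, pC ∘ₗ A ∘ₗ C.subtype), ⟨hx, trivial⟩, q ∘ₗ A ∘ₗ C.subtype, ?_⟩
    refine Prod.ext ?_ (LinearMap.ext fun v => ?_)
    · simp [ι, κ]
    · rw [Prod.snd_add, LinearMap.add_apply, hι2, hκ2]
      change A v = (pC (A (pC v)) : V) + i (x (q v)) + i (q (A (pC v)))
      rw [hpC (A _), hpC v, map_sub, hA]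
      abel
  · intro p hp φ h0
    have h1 : p.1 = 0 := by simpa [ι, κ] using congrArg Prod.fst h0
    have h2 : ∀ v, (p.2 (pC v) : V) + i (p.1 (q v)) + i (φ (pC v)) = 0 := fun v => by
      have := LinearMap.congr_fun (congrArg Prod.snd h0) v
      rwa [Prod.snd_add, LinearMap.add_apply, hι2, hκ2] at this
    have h3 : ∀ c : C, φ c = 0 := fun c => by
      have := congrArg q (h2 c)
      simpa [hpCc, hC, hq] using this
    refine ⟨Prod.ext h1 (LinearMap.ext fun n => Subtype.ext ?_), LinearMap.ext h3⟩
    simpa [hpCc, hC, h3] using h2 n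
  · intro p hp p' hp'
    refine Prod.ext rfl (LinearMap.ext fun v => ?_)
    simp only [Prod.snd_sub, Prod.snd_mul, LinearMap.sub_apply, Module.End.mul_apply, hι2,
      Prod.fst_mul, map_add, hpCc, hpCi, hC, hq, zero_add, add_zero, map_sub]
  · intro p hp φ
    refine Prod.ext (by simp [ι, κ]) (LinearMap.ext fun v => ?_)
    simp only [Prod.snd_sub, Prod.snd_mul, LinearMap.sub_apply, Module.End.mul_apply, hι2, hκ2,
      map_add, hpCc, hpCi, hq, map_zero, zero_add, add_zero, hact, LinearMap.comp_apply,
      map_sub, Submodule.coe_zero]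
  · intro φ φ'
    refine Prod.ext (by simp [κ]) (LinearMap.ext fun v => ?_)
    simp [hκ2, hpCi]

end Extensions

/-! ### Stabilizers that are skew on a subspace, and the orthogonal algebra -/

section SkewStab

variable {K : Type*} [Field K] {V : Type*} [AddCommGroup V] [Module K V]

/-- Endomorphisms preserving a subspace. -/
def stabSub (U : Submodule K V) : Submodule K (Module.End K V) where
  carrier := {A | ∀ u ∈ U, A u ∈ U}
  add_mem' := fun hA hB u hu => U.add_mem (hA u hu) (hB u hu)
  zero_mem' := fun _ _ => U.zero_mem
  smul_mem' := fun t _ hA u hu => U.smul_mem t (hA u hu)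

/-- Endomorphisms preserving `W` and acting on it by skew-adjoint maps with respect to `Q`. -/
def skewStab (W : Submodule K V) (Q : LinearMap.BilinForm K V) :
    Submodule K (Module.End K V) where
  carrier := {A | (∀ w ∈ W, A w ∈ W) ∧ ∀ w ∈ W, ∀ w' ∈ W, Q (A w) w' + Q w (A w') = 0}
  add_mem' := fun {A B} hA hB => ⟨fun w hw => W.add_mem (hA.1 w hw) (hB.1 w hw), fun w hw w' hw' => by
    have h1 := hA.2 w hw w' hw'
    have h2 := hB.2 w hw w' hw'
    simp only [LinearMap.add_apply, map_add]
    linear_combination h1 + h2⟩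
  zero_mem' := ⟨fun _ _ => W.zero_mem, fun w _ w' _ => by simp⟩
  smul_mem' := fun t A hA => ⟨fun w hw => W.smul_mem t (hA.1 w hw), fun w hw w' hw' => by
    have h1 := hA.2 w hw w' hw'
    simp only [LinearMap.smul_apply, map_smul, smul_eq_mul]
    linear_combination t * h1⟩

/-- `Q` is nondegenerate on `W`. -/
def NondegOn (Q : LinearMap.BilinForm K V) (W : Submodule K V) : Prop :=
  ∀ w ∈ W, (∀ w' ∈ W, Q w w' = 0) → w = 0

theorem commClosed_stabSub (U : Submodule K V) : CommClosed (stabSub U) := fun _ hA _ hB u hu =>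
  U.sub_mem (hA _ (hB u hu)) (hB _ (hA u hu))

theorem commClosed_skewStab (W : Submodule K V) (Q : LinearMap.BilinForm K V) :
    CommClosed (skewStab W Q) := fun A hA B hB =>
  ⟨fun w hw => W.sub_mem (hA.1 _ (hB.1 w hw)) (hB.1 _ (hA.1 w hw)), fun w hw w' hw' => by
    have h1 := hA.2 w hw (B w') (hB.1 _ hw')
    have h2 := hA.2 (B w) (hB.1 _ hw) w' hw'
    have h3 := hB.2 w hw (A w') (hA.1 _ hw')
    have h4 := hB.2 (A w) (hA.1 _ hw) w' hw'
    simp only [LinearMap.sub_apply, Module.End.mul_apply, map_sub]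
    linear_combination h1 + h2 - h3 - h4⟩

theorem commClosed_inf {R : Type*} [Ring R] [Algebra K R] {S S' : Submodule K R}
    (hS : CommClosed S) (hS' : CommClosed S') : CommClosed (S ⊓ S') := fun x hx y hy =>
  ⟨hS x hx.1 y hy.1, hS' x hx.2 y hy.2⟩

theorem restrict_isSymm {Q : LinearMap.BilinForm K V} (hQ : Q.IsSymm) (U : Submodule K V) :
    (Q.restrict U).IsSymm := ⟨fun x y => hQ.eq x y⟩

theorem nondegOn_restrict {Q : LinearMap.BilinForm K V} {U W : Submodule K V}
    (h : NondegOn Q (U ⊓ W)) : NondegOn (Q.restrict U) (W.comap U.subtype) := fun w hw hw' =>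
  Subtype.ext (h w ⟨w.2, hw⟩ fun v hv => hw' ⟨v, hv.1⟩ hv.2)

theorem nondegOn_restrict_of_le {Q : LinearMap.BilinForm K V} {U W : Submodule K V} (hWU : W ≤ U)
    (h : NondegOn Q W) : NondegOn (Q.restrict U) (W.comap U.subtype) :=
  nondegOn_restrict (by rwa [inf_eq_right.mpr hWU])

theorem finrank_comap_subtype_of_le {U W : Submodule K V} (hWU : W ≤ U) :
    Module.finrank K (W.comap U.subtype) = Module.finrank K W :=
  (Submodule.comapSubtypeEquivOfLe hWU).finrank_eq

theorem finrank_comap_subtype {U W : Submodule K V} :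
    Module.finrank K (W.comap U.subtype) = Module.finrank K ↥(U ⊓ W) := by
  rw [← finrank_comap_subtype_of_le (inf_le_left : U ⊓ W ≤ U)]
  have : W.comap U.subtype = (U ⊓ W).comap U.subtype := by ext; simp
  rw [this]

theorem isCompl_orthogonal [FiniteDimensional K V] {Q : LinearMap.BilinForm K V} (hQ : Q.IsSymm)
    {M : Submodule K V} (h : NondegOn Q M) : IsCompl M (Q.orthogonal M) := by
  refine LinearMap.BilinForm.isCompl_orthogonal_of_restrict_nondegenerate hQ.isRefl ?_
  have h1 : ∀ x : M, (∀ y : M, Q.restrict M x y = 0) → x = 0 := fun x hx =>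
    Subtype.ext (h x x.2 fun y hy => hx ⟨y, hy⟩)
  exact ⟨h1, fun x hx => h1 x fun y => by rw [(restrict_isSymm hQ M).eq]; exact hx y⟩

/-- The rank two skew-adjoint map attached to two vectors. -/
def skewPair (Q : LinearMap.BilinForm K V) (x y : V) : Module.End K V :=
  (Q x).smulRight y - (Q y).smulRight x

theorem skewPair_apply (Q : LinearMap.BilinForm K V) (x y v : V) :
    skewPair Q x y v = Q x v • y - Q y v • x := rfl

theorem skewPair_skew {Q : LinearMap.BilinForm K V} (hQ : Q.IsSymm) (x y v w : V) :
    Q (skewPair Q x y v) w + Q v (skewPair Q x y w) = 0 := by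
  simp only [skewPair_apply, map_sub, LinearMap.sub_apply, map_smul, LinearMap.smul_apply,
    smul_eq_mul]
  rw [hQ.eq v x, hQ.eq v y]
  ring

theorem skewPair_mem {Q : LinearMap.BilinForm K V} (hQ : Q.IsSymm) (x y : V) :
    skewPair Q x y ∈ skewStab ⊤ Q :=
  ⟨fun _ _ => trivial, fun v _ w _ => skewPair_skew hQ x y v w⟩

/-- Existence of adjoints, with equal trace. -/
theorem exists_adjoint [FiniteDimensional K V] {Q : LinearMap.BilinForm K V} (hQ : Q.IsSymm)
    (hn : NondegOn Q ⊤) (F : Module.End K V) :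
    ∃ F' : Module.End K V, (∀ x y, Q (F' x) y = Q x (F y)) ∧
      LinearMap.trace K V F' = LinearMap.trace K V F := by
  have h1 : ∀ x, (∀ y, Q x y = 0) → x = 0 := fun x hx => hn x trivial fun y _ => hx y
  have hnd : Q.Nondegenerate := ⟨h1, fun x hx => h1 x fun y => by rw [hQ.eq]; exact hx y⟩
  refine ⟨(Q.toDual hnd).symm.conj (Module.Dual.transpose F), fun x y => ?_, ?_⟩
  · rw [← LinearMap.BilinForm.toDual_def hnd, LinearEquiv.conj_apply]
    simp only [LinearMap.comp_apply, LinearEquiv.coe_coe, LinearEquiv.symm_symm,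
      LinearEquiv.apply_symm_apply]
    rfl
  · rw [LinearMap.trace_conj', LinearMap.trace_transpose']

theorem adjoint_unique {Q : LinearMap.BilinForm K V} (hn : NondegOn Q ⊤)
    {A B : Module.End K V} (h : ∀ x y, Q (A x) y = Q (B x) y) : A = B :=
  LinearMap.ext fun x => sub_eq_zero.mp (hn _ trivial fun y _ => by
    rw [map_sub, LinearMap.sub_apply, h, sub_self])

theorem skewStab_top_eq_zero [CharZero K] [FiniteDimensional K V] {Q : LinearMap.BilinForm K V}
    (hQ : Q.IsSymm) (hn : NondegOn Q ⊤) (hd : Module.finrank K V ≤ 1) {A : Module.End K V}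
    (hA : A ∈ skewStab ⊤ Q) : A = 0 := by
  obtain ⟨v, hv⟩ := finrank_le_one_iff.mp hd
  have h2 : Q (A v) v = 0 := by
    have := hA.2 v trivial v trivial
    rw [hQ.eq v, ← two_mul] at this
    exact (mul_eq_zero.mp this).resolve_left two_ne_zero
  ext w
  obtain ⟨c, rfl⟩ := hv w
  have : A v = 0 := hn _ trivial fun w' _ => by
    obtain ⟨c, rfl⟩ := hv w'
    rw [map_smul, h2, smul_zero]
  rw [map_smul, this, smul_zero, LinearMap.zero_apply]

/-- Through the trace form, f is represented on so(V) by a skew map G = F - F'. Since G commutes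
with itself it lies in the radical of the form of f, so G = 0 if f is nondegenerate. Then f vanishes
on so(V), which must itself be zero; the maps `skewPair` exclude this when there are two independent
vectors. -/
theorem isFrob_skewStab_top [CharZero K] [FiniteDimensional K V] {Q : LinearMap.BilinForm K V}
    (hQ : Q.IsSymm) (hn : NondegOn Q ⊤) :
    IsFrob (skewStab ⊤ Q) ↔ Module.finrank K V ≤ 1 := by
  refine ⟨fun ⟨f, hf⟩ => ?_, fun hd => ⟨0, fun A hA _ => skewStab_top_eq_zero hQ hn hd hA⟩⟩
  obtain ⟨F, hF⟩ := exists_eq_trace_comp f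
  obtain ⟨F', hF', -⟩ := exists_adjoint hQ hn F
  -- As A is skew, -F'A is the adjoint of AF, so its trace is that of AF, hence of FA.
  have hskew : ∀ A ∈ skewStab ⊤ Q, 2 * f A = LinearMap.trace K V ((F - F') * A) := by
    intro A hA
    obtain ⟨G, hG, hGt⟩ := exists_adjoint hQ hn (A * F)
    have hGe : G = -(F' * A) := adjoint_unique hn fun x y => by
      have := hA.2 x trivial (F y) trivial
      rw [hG, LinearMap.neg_apply, map_neg, LinearMap.neg_apply, Module.End.mul_apply,
        Module.End.mul_apply, hF']
      linear_combination this
    rw [hGe, map_neg, LinearMap.trace_mul_comm K A F] at hGt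
    have h1 : f A = LinearMap.trace K V (F * A) := hF A
    rw [sub_mul, map_sub, h1]
    linear_combination -hGt
  have hmem : F - F' ∈ skewStab ⊤ Q := ⟨fun _ _ => trivial, fun x _ y _ => by
    have h1 := hF' x y
    have h2 := hF' y x
    rw [hQ.eq _ x, hQ.eq y] at h2
    simp only [LinearMap.sub_apply, map_sub]
    linear_combination -h1 - h2⟩
  have hz : F - F' = 0 := hf _ hmem fun A hA => by
    have := hskew _ (commClosed_skewStab _ _ _ hmem A hA)
    generalize F - F' = G at this ⊢
    rw [mul_sub, map_sub (LinearMap.trace K V), ← mul_assoc G A, LinearMap.trace_mul_comm K (G * A),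
      sub_self] at this
    exact (mul_eq_zero.mp this).resolve_left two_ne_zero
  have hall : ∀ A ∈ skewStab ⊤ Q, A = 0 := fun A hA => hf A hA fun B hB => by
    have := hskew _ (commClosed_skewStab _ _ _ hA B hB)
    rw [hz, zero_mul, map_zero] at this
    exact (mul_eq_zero.mp this).resolve_left two_ne_zero
  rw [finrank_le_one_iff]
  by_cases hV : ∃ x : V, x ≠ 0
  · obtain ⟨x, hx⟩ := hV
    obtain ⟨v, hv⟩ : ∃ v, Q x v ≠ 0 := by
      by_contra! h
      exact hx (hn x trivial fun y _ => h y)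
    refine ⟨x, fun y => ⟨(Q x v)⁻¹ * Q y v, ?_⟩⟩
    have := LinearMap.congr_fun (hall _ (skewPair_mem hQ x y)) v
    rw [skewPair_apply, LinearMap.zero_apply, sub_eq_zero] at this
    rw [mul_smul, ← this, smul_smul, inv_mul_cancel₀ hv, one_smul]
  · push Not at hV
    exact ⟨0, fun w => ⟨0, by rw [hV w, smul_zero]⟩⟩

/-- When `U` and `W` span `V` and `Q` is nondegenerate on `U ⊓ W`, the common stabilizer splits. -/
theorem isFrob_stab_of_codisjoint [CharZero K] [FiniteDimensional K V]
    {Q : LinearMap.BilinForm K V} (hQ : Q.IsSymm) {U W : Submodule K V} (hUW : U ⊔ W = ⊤)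
    (hW : NondegOn Q W) (hM : NondegOn Q (U ⊓ W)) :
    IsFrob (stabSub U ⊓ skewStab W Q) ↔
      IsFrob (skewStab (W.comap U.subtype) (Q.restrict U)) ∧
        Module.finrank K V ≤ Module.finrank K U + 1 := by
  have hMc := isCompl_orthogonal hQ hM
  -- O is the orthogonal complement of U ⊓ W in W, hence a complement of U in V. Each A in the
  -- stabilizer preserves U ⊓ W and is skew on W, so it preserves O as well and splits along V = U ⊕
  -- O; the O-part is an arbitrary element of so(O).
  set O : Submodule K V := W ⊓ Q.orthogonal (U ⊓ W) with hO
  have hdecW : ∀ w ∈ W, ∃ m ∈ U ⊓ W, ∃ o ∈ O, m + o = w := fun w hw => by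
    have : w ∈ (U ⊓ W) ⊔ Q.orthogonal (U ⊓ W) := by rw [hMc.sup_eq_top]; trivial
    obtain ⟨m, hm, o, ho, rfl⟩ := Submodule.mem_sup.mp this
    exact ⟨m, hm, o, ⟨by simpa using W.sub_mem hw hm.2, ho⟩, rfl⟩
  have hMO : ∀ m ∈ U ⊓ W, ∀ o ∈ O, Q m o = 0 := fun m hm o ho => ho.2 m hm
  have hOM : ∀ m ∈ U ⊓ W, ∀ o ∈ O, Q o m = 0 := fun m hm o ho => by rw [hQ.eq, hMO m hm o ho]
  have hc : IsCompl U O := by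
    refine ⟨Submodule.disjoint_def.mpr fun x hxU hxO => ?_, codisjoint_iff.mpr ?_⟩
    · exact Submodule.disjoint_def.mp hMc.disjoint x ⟨hxU, hxO.1⟩ hxO.2
    · rw [eq_top_iff, ← hUW, sup_le_iff]
      refine ⟨le_sup_left, fun w hw => ?_⟩
      obtain ⟨m, hm, o, ho, rfl⟩ := hdecW w hw
      exact Submodule.add_mem_sup hm.1 ho
  have hOn : NondegOn (Q.restrict O) ⊤ := fun x _ hx => by
    refine Subtype.ext (hW x x.2.1 fun w hw => ?_)
    obtain ⟨m, hm, o, ho, rfl⟩ := hdecW w hw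
    rw [map_add, hOM m hm x x.2, zero_add]
    exact hx ⟨o, ho⟩ trivial
  have hfr := Submodule.finrank_add_eq_of_isCompl hc
  have hO1 := isFrob_skewStab_top (restrict_isSymm hQ O) hOn
  have hO2 : Module.finrank K V ≤ Module.finrank K U + 1 ↔ Module.finrank K O ≤ 1 := by omega
  rw [hO2, ← hO1, ← isFrob_prod]
  let pU := U.projectionOnto O hc
  let pO := O.projectionOnto U hc.symm
  have hpU : ∀ u : U, pU u = u := Submodule.projectionOnto_apply_left hc
  have hpUO : ∀ o : O, pU o = 0 := Submodule.projectionOnto_apply_right hc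
  have hpO : ∀ u : O, pO u = u := Submodule.projectionOnto_apply_left hc.symm
  have hpOU : ∀ u : U, pO u = 0 := Submodule.projectionOnto_apply_right hc.symm
  have hsum : ∀ v, (pU v : V) + pO v = v := Submodule.projection_add_projection_eq_self hc
  let T : Module.End K V →ₗ[K] Module.End K U × Module.End K O :=
    { toFun := fun A => (pU ∘ₗ A ∘ₗ U.subtype, pO ∘ₗ A ∘ₗ O.subtype)
      map_add' := fun A B => by
        refine Prod.ext (LinearMap.ext fun x => ?_) (LinearMap.ext fun x => ?_) <;> simp
      map_smul' := fun t A => by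
        refine Prod.ext (LinearMap.ext fun x => ?_) (LinearMap.ext fun x => ?_) <;> simp }
  have hAO : ∀ A ∈ stabSub U ⊓ skewStab W Q, ∀ o ∈ O, A o ∈ O := by
    rintro A ⟨hAU, hAW⟩ o ho
    refine ⟨hAW.1 o ho.1, fun m hm => ?_⟩
    have := hAW.2 m hm.2 o ho.1
    rwa [hMO (A m) ⟨hAU m hm.1, hAW.1 m hm.2⟩ o ho, zero_add] at this
  have hT1 : ∀ A ∈ stabSub U ⊓ skewStab W Q, ∀ u : U, ((T A).1 u : V) = A u := fun A hA u =>
    congrArg Subtype.val (hpU ⟨A u, hA.1 u u.2⟩)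
  have hT2 : ∀ A ∈ stabSub U ⊓ skewStab W Q, ∀ o : O, ((T A).2 o : V) = A o := fun A hA o =>
    congrArg Subtype.val (hpO ⟨A o, hAO A hA o o.2⟩)
  have hcl := commClosed_inf (commClosed_stabSub U) (commClosed_skewStab W Q)
  refine isFrob_congr hcl T ?_ ?_ ?_ ?_
  · refine fun A hA => ⟨⟨fun w hw => ?_, fun w hw w' hw' => ?_⟩,
      ⟨fun _ _ => trivial, fun w _ w' _ => ?_⟩⟩
    · rw [Submodule.mem_comap, Submodule.subtype_apply, hT1 A hA]
      exact hA.2.1 w hw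
    · change Q ((T A).1 w : V) w' + Q w ((T A).1 w' : V) = 0
      rw [hT1 A hA, hT1 A hA]
      exact hA.2.2 w hw w' hw'
    · change Q ((T A).2 w : V) w' + Q w ((T A).2 w' : V) = 0
      rw [hT2 A hA, hT2 A hA]
      exact hA.2.2 w w.2.1 w' w'.2.1
  · intro A hA h0
    ext v
    rw [← hsum v, map_add, ← hT1 A hA, ← hT2 A hA, h0]
    simp
  · rintro ⟨α, β⟩ ⟨hα, hβ⟩
    let A : Module.End K V := U.subtype ∘ₗ α ∘ₗ pU + O.subtype ∘ₗ β ∘ₗ pO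
    have hAu : ∀ u : U, A u = α u := fun u => by simp [A, hpU, hpOU]
    have hAo : ∀ o : O, A o = β o := fun o => by simp [A, hpO, hpUO]
    have hαM : ∀ m (hm : m ∈ U ⊓ W), (α ⟨m, hm.1⟩ : V) ∈ U ⊓ W := fun m hm =>
      ⟨Subtype.mem _, hα.1 ⟨m, hm.1⟩ hm.2⟩
    have hA : A ∈ stabSub U ⊓ skewStab W Q := by
      refine ⟨fun u hu => ?_, fun w hw => ?_, fun w hw w' hw' => ?_⟩
      · rw [hAu ⟨u, hu⟩]
        exact Subtype.mem _
      · obtain ⟨m, hm, o, ho, rfl⟩ := hdecW w hw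
        rw [map_add, hAu ⟨m, hm.1⟩, hAo ⟨o, ho⟩]
        exact W.add_mem (hαM m hm).2 (Subtype.mem (β ⟨o, ho⟩)).1
      · obtain ⟨m, hm, o, ho, rfl⟩ := hdecW w hw
        obtain ⟨m', hm', o', ho', rfl⟩ := hdecW w' hw'
        rw [map_add A m o, map_add A m' o', hAu ⟨m, hm.1⟩, hAo ⟨o, ho⟩, hAu ⟨m', hm'.1⟩, hAo ⟨o', ho'⟩]
        have e1 : Q (α ⟨m, hm.1⟩) m' + Q m (α ⟨m', hm'.1⟩) = 0 :=
          hα.2 ⟨m, hm.1⟩ hm.2 ⟨m', hm'.1⟩ hm'.2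
        have e2 : Q (β ⟨o, ho⟩) o' + Q o (β ⟨o', ho'⟩) = 0 :=
          hβ.2 ⟨o, ho⟩ trivial ⟨o', ho'⟩ trivial
        simp only [map_add, LinearMap.add_apply]
        rw [hMO _ (hαM m hm) o' ho', hOM _ (hαM m' hm') o ho,
          hOM m' hm' _ (Subtype.mem (β ⟨o, ho⟩)), hMO m hm _ (Subtype.mem (β ⟨o', ho'⟩))]
        linear_combination e1 + e2
    refine ⟨A, hA, Prod.ext (LinearMap.ext fun u => Subtype.ext ?_)
      (LinearMap.ext fun o => Subtype.ext ?_)⟩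
    · rw [hT1 A hA, hAu]
    · rw [hT2 A hA, hAo]
  · intro A hA B hB
    refine Prod.ext (LinearMap.ext fun u => Subtype.ext ?_) (LinearMap.ext fun o => Subtype.ext ?_)
    · rw [hT1 _ (hcl A hA B hB)]
      simp [hT1 A hA, hT1 B hB]
    · rw [hT2 _ (hcl A hA B hB)]
      simp [hT2 A hA, hT2 B hB]

end SkewStab

/-! ### Extensions of maximal rank as stabilizers, and stabilizers as extensions -/

section Identifications

variable {K : Type*} [Field K] {R : Type*} [Ring R] [Algebra K R]
  {V X Y : Type*} [AddCommGroup V] [Module K V] [AddCommGroup X] [Module K X]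
  [AddCommGroup Y] [Module K Y]

/-- When ξ is injective, the endomorphism of V is determined by x, and it exists exactly when ρ x
preserves the range of ξ. -/
theorem isFrob_quotExt_of_injective {h : Submodule K R} {ρ : R →ₗ[K] Module.End K Y}
    {ξ : V →ₗ[K] Y} (hh : CommClosed h)
    (hρ : ∀ x ∈ h, ∀ y ∈ h, ρ (x * y - y * x) = ρ x * ρ y - ρ y * ρ x)
    (hξ : Function.Injective ξ) :
    IsFrob (quotExt h ρ ξ) ↔ IsFrob (h ⊓ (stabSub (LinearMap.range ξ)).comap ρ) := by
  refine isFrob_congr (commClosed_quotExt hh hρ) (LinearMap.fst K R (Module.End K V)) ?_ ?_ ?_ ?_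
  · rintro p ⟨h1, h2⟩
    refine ⟨h1, ?_⟩
    rintro _ ⟨v, rfl⟩
    exact ⟨p.2 v, h2 v⟩
  · rintro p ⟨-, h2⟩ h0
    replace h0 : p.1 = 0 := h0
    refine Prod.ext h0 (LinearMap.ext fun v => hξ ?_)
    rw [h2, h0]
    simp
  · rintro x ⟨hx, hx'⟩
    obtain ⟨l, hl⟩ := ξ.exists_leftInverse_of_injective (LinearMap.ker_eq_bot.mpr hξ)
    refine ⟨(x, l ∘ₗ ρ x ∘ₗ ξ), ⟨hx, fun v => ?_⟩, rfl⟩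
    obtain ⟨w, hw⟩ := hx' (ξ v) ⟨v, rfl⟩
    have := LinearMap.congr_fun hl w
    simp only [LinearMap.comp_apply, LinearMap.id_apply] at this ⊢
    rw [← hw, this]
  · intros
    rfl

/-- When ξ is surjective, the endomorphism of V is determined by x, and it exists exactly when x
preserves the kernel of ξ. -/
theorem isFrob_subExt_of_surjective {h : Submodule K (Module.End K X)} (hh : CommClosed h)
    {ξ : X →ₗ[K] V} (hξ : Function.Surjective ξ) :
    IsFrob (subExt h ξ) ↔ IsFrob (stabSub (LinearMap.ker ξ) ⊓ h) := by
  refine isFrob_congr (commClosed_subExt hh)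
    (LinearMap.fst K (Module.End K X) (Module.End K V)) ?_ ?_ ?_ ?_
  · rintro p ⟨h1, h2⟩
    refine ⟨fun v hv => ?_, h1⟩
    change ξ (p.1 v) = 0
    rw [← h2, LinearMap.mem_ker.mp hv, map_zero]
  · rintro p ⟨-, h2⟩ h0
    replace h0 : p.1 = 0 := h0
    refine Prod.ext h0 (LinearMap.ext fun v => ?_)
    obtain ⟨x, rfl⟩ := hξ v
    rw [h2, h0]
    simp
  · rintro x ⟨hx', hx⟩
    obtain ⟨s, hs⟩ := ξ.exists_rightInverse_of_surjective (LinearMap.range_eq_top.mpr hξ)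
    refine ⟨(x, ξ ∘ₗ x ∘ₗ s), ⟨hx, fun v => ?_⟩, rfl⟩
    have h1 : ξ (s (ξ v)) = ξ v := LinearMap.congr_fun hs (ξ v)
    have h2 : ξ (x (s (ξ v) - v)) = 0 := hx' _ (by rw [LinearMap.mem_ker, map_sub, h1, sub_self])
    rw [map_sub, map_sub, sub_eq_zero] at h2
    exact h2
  · intros
    rfl

theorem isFrob_stab_of_le {U W : Submodule K V} (hWU : W ≤ U) (Q : LinearMap.BilinForm K V) :
    IsFrob (stabSub U ⊓ skewStab W Q) ↔
      IsFrob (subExt (skewStab (W.comap U.subtype) (Q.restrict U)) U.subtype) := by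
  symm
  refine isFrob_congr (commClosed_subExt (commClosed_skewStab _ _))
    (LinearMap.snd K (Module.End K U) (Module.End K V)) ?_ ?_ ?_ ?_
  · rintro p ⟨h1, h2⟩
    replace h2 : ∀ u : U, p.2 u = p.1 u := h2
    refine ⟨fun u hu => ?_, fun w hw => ?_, fun w hw w' hw' => ?_⟩
    · change p.2 u ∈ U
      rw [h2 ⟨u, hu⟩]
      exact Subtype.mem _
    · change p.2 w ∈ W
      rw [h2 ⟨w, hWU hw⟩]
      exact h1.1 ⟨w, hWU hw⟩ hw
    · change Q (p.2 w) w' + Q w (p.2 w') = 0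
      rw [h2 ⟨w, hWU hw⟩, h2 ⟨w', hWU hw'⟩]
      exact h1.2 ⟨w, hWU hw⟩ hw ⟨w', hWU hw'⟩ hw'
  · rintro p ⟨-, h2⟩ h0
    replace h0 : p.2 = 0 := h0
    refine Prod.ext (LinearMap.ext fun v => Subtype.ext ?_) h0
    have := h2 v
    rw [h0] at this
    exact this.symm
  · rintro A ⟨hA, hAW⟩
    exact ⟨((A ∘ₗ U.subtype).codRestrict U fun u => hA u u.2, A),
      ⟨⟨fun w hw => hAW.1 w hw, fun w hw w' hw' => hAW.2 w hw w' hw'⟩, fun v => rfl⟩, rfl⟩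
  · intros
    rfl

/-- The endomorphism of `V ⧸ W` induced by an endomorphism preserving `W`. -/
noncomputable def quotRep (W : Submodule K V) : Module.End K V →ₗ[K] Module.End K (V ⧸ W) where
  -- An arbitrary section keeps the definition linear on all endomorphisms; the value is independent
  -- of it, and multiplicative, only for maps preserving W.
  toFun x := W.mkQ ∘ₗ x ∘ₗ Classical.choose (W.mkQ.exists_rightInverse_of_surjective W.range_mkQ)
  map_add' x y := by ext; simp
  map_smul' t x := by ext; simp

theorem quotRep_apply {W : Submodule K V} {x : Module.End K V} (hx : ∀ w ∈ W, x w ∈ W) (v : V) :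
    quotRep W x (W.mkQ v) = W.mkQ (x v) := by
  have hs := Classical.choose_spec (W.mkQ.exists_rightInverse_of_surjective W.range_mkQ)
  set s := Classical.choose (W.mkQ.exists_rightInverse_of_surjective W.range_mkQ)
  have h1 : W.mkQ (s (W.mkQ v)) = W.mkQ v := LinearMap.congr_fun hs _
  change W.mkQ (x (s (W.mkQ v))) = _
  rw [← sub_eq_zero, ← map_sub, ← map_sub, Submodule.mkQ_apply, Submodule.Quotient.mk_eq_zero]
  apply hx
  rwa [← Submodule.Quotient.mk_eq_zero, ← Submodule.mkQ_apply, map_sub, sub_eq_zero]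

theorem quotRep_comm {W : Submodule K V} {Q : LinearMap.BilinForm K V} :
    ∀ x ∈ skewStab W Q, ∀ y ∈ skewStab W Q,
      quotRep W (x * y - y * x) = quotRep W x * quotRep W y - quotRep W y * quotRep W x := by
  intro x hx y hy
  refine LinearMap.ext fun v => ?_
  obtain ⟨v, rfl⟩ := W.mkQ_surjective v
  rw [quotRep_apply (commClosed_skewStab W Q x hx y hy).1]
  simp only [LinearMap.sub_apply, Module.End.mul_apply, quotRep_apply hx.1, quotRep_apply hy.1,
    map_sub]

/-- Every endomorphism of the quotient is induced by an element of `skewStab W Q`. -/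
theorem quotRep_surj (W : Submodule K V) (Q : LinearMap.BilinForm K V)
    (B : Module.End K (V ⧸ W)) : ∃ x ∈ skewStab W Q, quotRep W x = B := by
  obtain ⟨s, hs⟩ := W.mkQ.exists_rightInverse_of_surjective W.range_mkQ
  have hw : ∀ w ∈ W, (s ∘ₗ B ∘ₗ W.mkQ) w = 0 := fun w hw => by
    have : W.mkQ w = 0 := by rwa [Submodule.mkQ_apply, Submodule.Quotient.mk_eq_zero]
    rw [LinearMap.comp_apply, LinearMap.comp_apply, this, map_zero, map_zero]
  have hmem : s ∘ₗ B ∘ₗ W.mkQ ∈ skewStab W Q :=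
    ⟨fun w h => by rw [hw w h]; exact W.zero_mem, fun w h w' h' => by
      rw [hw w h, hw w' h']; simp⟩
  refine ⟨_, hmem, LinearMap.ext fun v => ?_⟩
  obtain ⟨v, rfl⟩ := W.mkQ_surjective v
  rw [quotRep_apply hmem.1]
  exact LinearMap.congr_fun hs _

/-- Turns the outcome of an injective `quotExt` step into the stabilizer of a subspace containing W,
to which `isFrob_stab_of_le` applies. -/
theorem comap_mkQ_stab (W : Submodule K V) (Q : LinearMap.BilinForm K V)
    (Y' : Submodule K (V ⧸ W)) :
    skewStab W Q ⊓ (stabSub Y').comap (quotRep W) =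
      stabSub (Y'.comap W.mkQ) ⊓ skewStab W Q := by
  ext x
  constructor
  · rintro ⟨h1, h2⟩
    refine ⟨fun v hv => ?_, h1⟩
    rw [Submodule.mem_comap, ← quotRep_apply h1.1]
    exact h2 _ hv
  · rintro ⟨h2, h1⟩
    refine ⟨h1, fun v hv => ?_⟩
    obtain ⟨v, rfl⟩ := W.mkQ_surjective v
    rw [quotRep_apply h1.1]
    exact h2 v hv

/-- The common stabilizer of disjoint subspaces `U` and `W`, with `Z ⊇ W` a complement of `U`. -/
theorem isFrob_stab_of_disjoint {U W Z : Submodule K V} (Q : LinearMap.BilinForm K V)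
    (hWZ : W ≤ Z) (hc : IsCompl U Z) :
    IsFrob (stabSub U ⊓ skewStab W Q) ↔
      IsFrob (quotExt (skewStab (W.comap Z.subtype) (Q.restrict Z))
        (quotRep (W.comap Z.subtype)) (LinearMap.snd K U (Z ⧸ W.comap Z.subtype))) := by
  symm
  set W' := W.comap Z.subtype with hW'
  let pU := U.projectionOnto Z hc
  let pZ := Z.projectionOnto U hc.symm
  have hpU : ∀ u : U, pU u = u := Submodule.projectionOnto_apply_left hc
  have hpUZ : ∀ o : Z, pU o = 0 := Submodule.projectionOnto_apply_right hc
  have hpZ : ∀ u : Z, pZ u = u := Submodule.projectionOnto_apply_left hc.symm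
  have hpZU : ∀ u : U, pZ u = 0 := Submodule.projectionOnto_apply_right hc.symm
  have hsum : ∀ v, (pU v : V) + pZ v = v := Submodule.projection_add_projection_eq_self hc
  -- A map A in the stabilizer sends W into W ≤ Z, so its U-component kills W and factors through U
  -- × (Z ⧸ W). Its Z-component kills U and is the skew part. The two parts have to agree only on Z
  -- ⧸ W.
  let j : V →ₗ[K] U × (Z ⧸ W') := pU.prod (W'.mkQ ∘ₗ pZ)
  let T : Module.End K Z × Module.End K (U × (Z ⧸ W')) →ₗ[K] Module.End K V :=
    { toFun := fun p => U.subtype ∘ₗ LinearMap.fst K _ _ ∘ₗ p.2 ∘ₗ j + Z.subtype ∘ₗ p.1 ∘ₗ pZ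
      map_add' := fun p q => by
        ext v
        simp only [Prod.fst_add, Prod.snd_add, LinearMap.add_apply, LinearMap.comp_apply, map_add]
        abel
      map_smul' := fun t p => by
        ext v
        simp }
  have hT : ∀ p v, T p v = ((p.2 (j v)).1 : V) + p.1 (pZ v) := fun p v => rfl
  have hmk : ∀ w : Z, (w : V) ∈ W → W'.mkQ w = 0 := fun w hw => by
    rw [Submodule.mkQ_apply, Submodule.Quotient.mk_eq_zero]; exact hw
  have hju : ∀ u : U, j u = (u, 0) := fun u => by simp [j, hpU, hpZU]
  have hjz : ∀ z : Z, j z = (0, W'.mkQ z) := fun z => by simp [j, hpZ, hpUZ]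
  have hjw : ∀ w (hw : w ∈ W), j w = 0 := fun w hw => by
    rw [hjz ⟨w, hWZ hw⟩, hmk _ hw]; rfl
  have hTw : ∀ p w (hw : w ∈ W), T p w = p.1 ⟨w, hWZ hw⟩ := fun p w hw => by
    rw [hT, hjw w hw, map_zero, ← hpZ ⟨w, hWZ hw⟩]
    simp
  have hjT : ∀ p ∈ quotExt (skewStab W' (Q.restrict Z)) (quotRep W') (LinearMap.snd K U (Z ⧸ W')),
      ∀ v, j (T p v) = p.2 (j v) ∧ pZ (T p v) = p.1 (pZ v) := by
    rintro p ⟨h1, h2⟩ v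
    have h3 := h2 (j v)
    have h4 : (p.2 (j v)).2 = W'.mkQ (p.1 (pZ v)) := h3.trans (quotRep_apply h1.1 (pZ v))
    rw [hT, map_add, map_add, hju, hjz, hpZ, hpZU, zero_add, ← h4]
    exact ⟨by simp, rfl⟩
  have hcl := commClosed_quotExt (π := LinearMap.snd K U (Z ⧸ W'))
    (commClosed_skewStab W' (Q.restrict Z)) quotRep_comm
  refine isFrob_congr hcl T ?_ ?_ ?_ ?_
  · rintro p ⟨h1, h2⟩
    refine ⟨fun u hu => ?_, fun w hw => ?_, fun w hw w' hw' => ?_⟩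
    · rw [hT, show pZ u = 0 from hpZU ⟨u, hu⟩]
      simp
    · rw [hTw p w hw]
      exact h1.1 ⟨w, hWZ hw⟩ hw
    · rw [hTw p w hw, hTw p w' hw']
      exact h1.2 ⟨w, hWZ hw⟩ hw ⟨w', hWZ hw'⟩ hw'
  · rintro p hp h0
    refine Prod.ext (LinearMap.ext fun z => ?_) (LinearMap.ext fun y => ?_)
    · have := (hjT p hp z).2
      rw [h0, hpZ, LinearMap.zero_apply, map_zero] at this
      exact this.symm
    · obtain ⟨u, q⟩ := y
      obtain ⟨z, rfl⟩ := W'.mkQ_surjective q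
      have e : j (u + z) = (u, W'.mkQ z) := by rw [map_add, hju, hjz]; simp
      rw [← e, ← (hjT p hp _).1, h0]
      simp
  · rintro A ⟨hAU, hAW⟩
    let δ : Module.End K Z := pZ ∘ₗ A ∘ₗ Z.subtype
    have hδw : ∀ w : Z, (w : V) ∈ W → (δ w : V) = A w := fun w hw =>
      congrArg Subtype.val (hpZ ⟨A w, hWZ (hAW.1 w hw)⟩)
    have hδ : δ ∈ skewStab W' (Q.restrict Z) := by
      refine ⟨fun w hw => ?_, fun w hw w' hw' => ?_⟩
      · change (δ w : V) ∈ W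
        rw [hδw w hw]
        exact hAW.1 w hw
      · change Q (δ w : V) w' + Q w (δ w' : V) = 0
        rw [hδw w hw, hδw w' hw']
        exact hAW.2 w hw w' hw'
    let φ : (Z ⧸ W') →ₗ[K] U := W'.liftQ (pU ∘ₗ A ∘ₗ Z.subtype) fun w hw => by
      change pU (A w) = 0
      exact hpUZ ⟨A w, hWZ (hAW.1 w hw)⟩
    let α : Module.End K U := pU ∘ₗ A ∘ₗ U.subtype
    refine ⟨(δ, (α.coprod φ).prod (quotRep W' δ ∘ₗ LinearMap.snd K _ _)), ⟨hδ, fun v => rfl⟩,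
      LinearMap.ext fun v => ?_⟩
    rw [hT]
    have h1 : A (pU v) = α (pU v) := (congrArg Subtype.val (hpU ⟨A (pU v), hAU _ (pU v).2⟩)).symm
    have h2 : A (pZ v) = pU (A (pZ v)) + pZ (A (pZ v)) := (hsum _).symm
    have h3 : A v = A (pU v) + A (pZ v) := by rw [← map_add, hsum]
    change ((α (pU v) + φ (W'.mkQ (pZ v)) : U) : V) + pZ (A (pZ v)) = A v
    rw [h3, h1, Submodule.coe_add, add_assoc]
    exact congrArg _ h2.symm
  · intro p hp q hq
    refine LinearMap.ext fun v => ?_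
    rw [hT, LinearMap.sub_apply, Module.End.mul_apply, Module.End.mul_apply, hT p (T q v),
      hT q (T p v), (hjT q hq v).1, (hjT q hq v).2, (hjT p hp v).1, (hjT p hp v).2]
    simp only [Prod.snd_sub, Prod.snd_mul, Prod.fst_sub, Prod.fst_mul, LinearMap.sub_apply,
      Module.End.mul_apply, Submodule.coe_sub]
    abel

end Identifications

/-! ### Openness conditions and the existence of generic maps -/

section Steps

variable {K : Type*} [Field K] {V X Y : Type*} [AddCommGroup V] [Module K V] [AddCommGroup X]
  [Module K X] [AddCommGroup Y] [Module K Y]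

/-- A map of maximal rank is characterised by the absence of maps vanishing on its image with image
in its kernel. -/
theorem injective_or_surjective (ξ : X →ₗ[K] Y)
    (h : ∀ φ : Y →ₗ[K] X, φ ∘ₗ ξ = 0 → ξ ∘ₗ φ = 0 → φ = 0) :
    Function.Injective ξ ∨ Function.Surjective ξ := by
  by_contra! hcon
  obtain ⟨h1, h2⟩ := hcon
  obtain ⟨x, hx, hx0⟩ : ∃ x, ξ x = 0 ∧ x ≠ 0 := by
    by_contra! h'
    exact h1 (LinearMap.ker_eq_bot.mp (LinearMap.ker_eq_bot'.mpr h'))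
  have hlt : LinearMap.range ξ < ⊤ := lt_top_iff_ne_top.mpr fun e => h2 (LinearMap.range_eq_top.mp e)
  obtain ⟨l, hl0, hl⟩ := (LinearMap.range ξ).exists_le_ker_of_lt_top hlt
  have hφ := h (l.smulRight x)
    (LinearMap.ext fun y => by
      have : l (ξ y) = 0 := hl ⟨y, rfl⟩
      simp [this])
    (LinearMap.ext fun y => by simp [hx])
  refine hl0 (LinearMap.ext fun y => ?_)
  have := LinearMap.congr_fun hφ y
  simpa [hx0] using this

theorem eq_zero_of_comp_surjective {ξ : X →ₗ[K] Y} (hξ : Function.Surjective ξ) {φ : Y →ₗ[K] V}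
    (h : φ ∘ₗ ξ = 0) : φ = 0 :=
  LinearMap.ext fun y => by
    obtain ⟨x, rfl⟩ := hξ y
    exact LinearMap.congr_fun h x

theorem eq_zero_of_injective_comp {ξ : X →ₗ[K] Y} (hξ : Function.Injective ξ) {φ : V →ₗ[K] X}
    (h : ξ ∘ₗ φ = 0) : φ = 0 :=
  LinearMap.ext fun y => hξ (by rw [LinearMap.zero_apply, map_zero]; exact LinearMap.congr_fun h y)

theorem exists_not_isotropic [CharZero K] {W : Submodule K X} {Q : LinearMap.BilinForm K X}
    (hQ : Q.IsSymm) (hW : NondegOn Q W) (hr : 1 ≤ Module.finrank K W) :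
    ∃ w ∈ W, Q w w ≠ 0 := by
  by_contra! h
  have : W = ⊥ := by
    rw [Submodule.eq_bot_iff]
    refine fun w hw => hW w hw fun w' hw' => ?_
    have h1 := h _ (W.add_mem hw hw')
    simp only [map_add, LinearMap.add_apply, h w hw, h w' hw', hQ.eq w' w] at h1
    have h2 : 2 * Q w w' = 0 := by linear_combination h1
    exact (mul_eq_zero.mp h2).resolve_left two_ne_zero
  rw [this, finrank_bot] at hr
  omega

/-- The kernel is the hyperplane orthogonal to a non-isotropic vector of W. The bound dim Y ≤ 1
suffices because the numerical criterion fails otherwise in the case where this witness is needed.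
-/
theorem exists_surjective_nondegOn [CharZero K] [FiniteDimensional K Y] {W : Submodule K X} {Q : LinearMap.BilinForm K X}
    (hQ : Q.IsSymm) (hW : NondegOn Q W) (hr : 1 ≤ Module.finrank K W)
    (hY : Module.finrank K Y ≤ 1) :
    ∃ ξ : X →ₗ[K] Y, Function.Surjective ξ ∧ LinearMap.ker ξ ⊔ W = ⊤ ∧
      NondegOn Q (LinearMap.ker ξ ⊓ W) := by
  obtain ⟨c, hc⟩ := finrank_le_one_iff.mp hY
  by_cases hc0 : c = 0
  · refine ⟨0, fun y => ⟨0, ?_⟩, ?_, ?_⟩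
    · obtain ⟨t, rfl⟩ := hc y
      simp [hc0]
    · simp
    · simpa using hW
  obtain ⟨w, hw, hww⟩ := exists_not_isotropic hQ hW hr
  have hker : ∀ x, x ∈ LinearMap.ker ((Q w).smulRight c) ↔ Q w x = 0 := fun x => by
    simp [hc0]
  have hdec : ∀ x, x - (Q w x / Q w w) • w ∈ LinearMap.ker ((Q w).smulRight c) := fun x => by
    rw [hker, map_sub, map_smul, smul_eq_mul, div_mul_cancel₀ _ hww, sub_self]
  refine ⟨(Q w).smulRight c, fun y => ?_, ?_, fun m hm hmm => ?_⟩
  · obtain ⟨t, rfl⟩ := hc y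
    refine ⟨(t / Q w w) • w, ?_⟩
    rw [LinearMap.smulRight_apply, map_smul, smul_eq_mul, div_mul_cancel₀ _ hww]
  · rw [eq_top_iff]
    intro x _
    exact Submodule.mem_sup.mpr ⟨_, hdec x, _, W.smul_mem _ hw, sub_add_cancel _ _⟩
  · refine hW m hm.2 fun w' hw' => ?_
    have h1 := hmm _ ⟨hdec w', W.sub_mem hw' (W.smul_mem _ hw)⟩
    have h2 : Q m w = 0 := by rw [hQ.eq]; exact (hker m).mp hm.1
    rwa [map_sub, map_smul, h2, smul_zero, sub_zero] at h1

variable [FiniteDimensional K V] [FiniteDimensional K X] [FiniteDimensional K Y]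

theorem exists_surjective_of_finrank_le (h : Module.finrank K Y ≤ Module.finrank K X) :
    ∃ ξ : X →ₗ[K] Y, Function.Surjective ξ := by
  obtain ⟨k, hk⟩ := finrank_le_iff_exists_linearMap.mp h
  obtain ⟨ξ, hξ⟩ := k.exists_leftInverse_of_injective (LinearMap.ker_eq_bot.mpr hk)
  exact ⟨ξ, fun y => ⟨k y, LinearMap.congr_fun hξ y⟩⟩

/-- The reduction for `quotExt` over `skewStab W Q`. -/
theorem isFrob_quotExt_skewStab (W : Submodule K X) (Q : LinearMap.BilinForm K X)
    {π : V →ₗ[K] X ⧸ W} (hπ : Function.Surjective π) :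
    IsFrob (quotExt (skewStab W Q) (quotRep W) π) ↔ ∃ ξ : LinearMap.ker π →ₗ[K] X ⧸ W,
      (Function.Injective ξ ∨ Function.Surjective ξ) ∧
        IsFrob (quotExt (skewStab W Q) (quotRep W) ξ) := by
  rw [isFrob_quotExt (commClosed_skewStab W Q) quotRep_comm hπ]
  refine exists_congr fun ξ => and_congr_left fun _ => ⟨fun h => ?_, fun h φ h1 h2 => ?_⟩
  · refine injective_or_surjective ξ fun φ h1 h2 => h φ h1 fun x _ => ?_
    rw [← LinearMap.comp_assoc, h2, LinearMap.zero_comp, map_zero]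
  · rcases h with h | h
    -- Since `quotRep` maps onto all of gl(Z ⧸ W), the trace condition already forces ξ ∘ φ = 0.
    · refine eq_zero_of_injective_comp h (eq_zero_of_trace_comp _ fun B => ?_)
      obtain ⟨x, hx, rfl⟩ := quotRep_surj W Q B
      rw [LinearMap.comp_assoc]
      exact h2 x hx
    · exact eq_zero_of_comp_surjective h h1

theorem trace_smulRight_comp (l : Y →ₗ[K] K) (m : X) (ξ : X →ₗ[K] Y) (x : Module.End K X) :
    LinearMap.trace K X (l.smulRight m ∘ₗ ξ ∘ₗ x) = l (ξ (x m)) := by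
  rw [LinearMap.trace_comp_comm', trace_comp_smulRight]
  rfl

/-- For surjective `ξ`, the openness condition for `subExt` over `skewStab W Q` in terms of the
kernel of `ξ`. -/
theorem open_iff_of_surjective [CharZero K] {W : Submodule K X} {Q : LinearMap.BilinForm K X} (hQ : Q.IsSymm)
    (hW : NondegOn Q W) {ξ : X →ₗ[K] Y} (hξ : Function.Surjective ξ) :
    (∀ φ : Y →ₗ[K] X, ξ ∘ₗ φ = 0 →
      (∀ x ∈ skewStab W Q, LinearMap.trace K X (φ ∘ₗ ξ ∘ₗ x) = 0) → φ = 0) ↔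
    Disjoint (LinearMap.ker ξ) W ∨
      (LinearMap.ker ξ ⊔ W = ⊤ ∧ NondegOn Q (LinearMap.ker ξ ⊓ W)) := by
  set N := LinearMap.ker ξ with hN
  constructor
  · intro h
    -- Openness is tested on the rank one maps φ = l ⊗ m with m in the kernel N.
    have key : ∀ (l : Y →ₗ[K] K) (m : X), m ∈ N → (∀ x ∈ skewStab W Q, l (ξ (x m)) = 0) →
        m ≠ 0 → l = 0 := by
      intro l m hm hl hm0
      have hφ := h (l.smulRight m)
        (LinearMap.ext fun y => by simp [LinearMap.mem_ker.mp hm])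
        (fun x hx => by rw [trace_smulRight_comp, hl x hx])
      refine LinearMap.ext fun y => ?_
      have := LinearMap.congr_fun hφ y
      simpa [hm0] using this
    by_cases hd : Disjoint N W
    · exact Or.inl hd
    right
    obtain ⟨m, hmN, hmW, hm0⟩ : ∃ m ∈ N, m ∈ W ∧ m ≠ 0 := by
      by_contra! h'
      exact hd (Submodule.disjoint_def.mpr h')
    have hmap : W.map ξ = ⊤ := by
      by_contra hne
      obtain ⟨l, hl0, hl⟩ := (W.map ξ).exists_le_ker_of_lt_top (lt_top_iff_ne_top.mpr hne)
      exact hl0 (key l m hmN (fun x hx => hl ⟨x m, hx.1 m hmW, rfl⟩) hm0)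
    refine ⟨?_, fun m hm hmm => ?_⟩
    · rw [eq_top_iff]
      intro x _
      have : ξ x ∈ W.map ξ := by rw [hmap]; trivial
      obtain ⟨w, hw, hwx⟩ := this
      refine Submodule.mem_sup.mpr ⟨x - w, ?_, w, hw, sub_add_cancel _ _⟩
      rw [hN, LinearMap.mem_ker, map_sub, hwx, sub_self]
    · by_contra hm0
      have hsurj : Function.Surjective (ξ ∘ₗ W.subtype) := fun y => by
        have : y ∈ W.map ξ := by rw [hmap]; trivial
        obtain ⟨w, hw, rfl⟩ := this
        exact ⟨⟨w, hw⟩, rfl⟩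
      -- If m is in the radical of Q on N ⊓ W, then Q m restricted to W descends through ξ to a
      -- functional on Y. Skewness gives Q m (x m) = 0, so `key` kills this functional, and Q would
      -- be degenerate on W.
      obtain ⟨s, hs⟩ := (ξ ∘ₗ W.subtype).exists_rightInverse_of_surjective
        (LinearMap.range_eq_top.mpr hsurj)
      have hlw : ∀ w ∈ W, Q m (s (ξ w)) = Q m w := fun w hw => by
        have h1 : ξ (s (ξ w)) = ξ w := LinearMap.congr_fun hs (ξ w)
        have h2 : (s (ξ w) : X) - w ∈ N ⊓ W :=
          ⟨by change ξ _ = 0; rw [map_sub, h1, sub_self], W.sub_mem (s (ξ w)).2 hw⟩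
        have := hmm _ h2
        rwa [map_sub, sub_eq_zero] at this
      have hl := key (Q m ∘ₗ W.subtype ∘ₗ s) m hm.1 (fun x hx => by
        have h1 := hx.2 m hm.2 m hm.2
        have h3 : (Q m ∘ₗ W.subtype ∘ₗ s) (ξ (x m)) = Q m (x m) := hlw _ (hx.1 m hm.2)
        rw [hQ.eq (x m) m, ← two_mul] at h1
        rw [h3]
        exact (mul_eq_zero.mp h1).resolve_left two_ne_zero) hm0
      exact hm0 (hW m hm.2 fun w hw => by
        rw [← hlw w hw]
        exact LinearMap.congr_fun hl (ξ w))
  · intro h φ h1 h2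
    refine eq_zero_of_comp_surjective hξ ?_
    set ψ := φ ∘ₗ ξ with hψ
    have hψN : ∀ y ∈ N, ψ y = 0 := fun y hy => by
      rw [hψ, LinearMap.comp_apply, LinearMap.mem_ker.mp hy, map_zero]
    -- Every endomorphism killing W belongs to `skewStab W Q`; rank one maps of this type force the
    -- image of ψ into W.
    have hψM : ∀ y, ψ y ∈ N ⊓ W := fun y => by
      refine ⟨LinearMap.congr_fun h1 (ξ y), ?_⟩
      by_contra hy
      obtain ⟨l, hl0, hl⟩ := Submodule.exists_le_ker_of_notMem hy
      have hx : l.smulRight y ∈ skewStab W Q := by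
        have hz : ∀ w ∈ W, l.smulRight y w = 0 := fun w hw => by
          have : l w = 0 := hl hw
          simp [this]
        exact ⟨fun w hw => by rw [hz w hw]; exact W.zero_mem, fun w hw w' hw' => by
          rw [hz w hw, hz w' hw']; simp⟩
      have := h2 _ hx
      rw [← LinearMap.comp_assoc, trace_comp_smulRight] at this
      exact hl0 this
    rcases h with h | ⟨hs, hn⟩
    · exact LinearMap.ext fun y => Submodule.disjoint_def.mp h _ (hψM y).1 (hψM y).2
    · have hc := isCompl_orthogonal hQ hn
      -- Pairing ψ with `skewPair Q m o` leaves Q m (ψ o), since ψ kills m; nondegeneracy on N ⊓ W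
      -- then gives ψ o = 0.
      have hψO : ∀ o ∈ W, o ∈ Q.orthogonal (N ⊓ W) → ψ o = 0 := fun o ho ho' => by
        refine hn _ (hψM o) fun m hm => ?_
        have hx : skewPair Q m o ∈ skewStab W Q :=
          ⟨fun w _ => W.sub_mem (W.smul_mem _ ho) (W.smul_mem _ hm.2),
            fun w _ w' _ => skewPair_skew hQ m o w w'⟩
        have := h2 _ hx
        rw [← LinearMap.comp_assoc, skewPair, LinearMap.comp_sub, map_sub, trace_comp_smulRight,
          trace_comp_smulRight, ← hψ, hψN m hm.1, map_zero, sub_zero] at this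
        rw [hQ.eq, this]
      ext x
      have hx : x ∈ N ⊔ W := by rw [hs]; trivial
      obtain ⟨n, hn', w, hw, rfl⟩ := Submodule.mem_sup.mp hx
      have hw' : w ∈ (N ⊓ W) ⊔ Q.orthogonal (N ⊓ W) := by rw [hc.sup_eq_top]; trivial
      obtain ⟨m, hm, o, ho, rfl⟩ := Submodule.mem_sup.mp hw'
      rw [map_add, map_add, hψN n hn', hψN m hm.1, hψO o (by simpa using W.sub_mem hw hm.2) ho]
      simp

/-- The reduction for `subExt` over `skewStab W Q`. -/
theorem isFrob_subExt_skewStab [CharZero K] {W : Submodule K X} {Q : LinearMap.BilinForm K X} (hQ : Q.IsSymm)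
    (hW : NondegOn Q W) {i : X →ₗ[K] V} {q : V →ₗ[K] X} (hq : ∀ x, q (i x) = x) :
    IsFrob (subExt (skewStab W Q) i) ↔ ∃ ξ : X →ₗ[K] LinearMap.ker q,
      (Function.Injective ξ ∧ IsFrob (subExt (skewStab W Q) ξ)) ∨
      (Function.Surjective ξ ∧ (Disjoint (LinearMap.ker ξ) W ∨
        (LinearMap.ker ξ ⊔ W = ⊤ ∧ NondegOn Q (LinearMap.ker ξ ⊓ W))) ∧
        IsFrob (stabSub (LinearMap.ker ξ) ⊓ skewStab W Q)) := by
  rw [isFrob_subExt (commClosed_skewStab W Q) hq]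
  refine exists_congr fun ξ => ?_
  constructor
  · rintro ⟨h1, h2⟩
    have hr : Function.Injective ξ ∨ Function.Surjective ξ :=
      injective_or_surjective ξ fun φ h3 h4 => h1 φ h4 fun x _ => by
        rw [← LinearMap.comp_assoc, h3, LinearMap.zero_comp, map_zero]
    rcases hr with hr | hr
    · exact Or.inl ⟨hr, h2⟩
    · exact Or.inr ⟨hr, (open_iff_of_surjective hQ hW hr).mp h1,
        (isFrob_subExt_of_surjective (commClosed_skewStab W Q) hr).mp h2⟩
  · rintro (⟨h1, h2⟩ | ⟨h1, h2, h3⟩)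
    · exact ⟨fun φ h3 _ => eq_zero_of_injective_comp h1 h3, h2⟩
    · exact ⟨(open_iff_of_surjective hQ hW h1).mpr h2,
        (isFrob_subExt_of_surjective (commClosed_skewStab W Q) h1).mpr h3⟩

/-- An injection of W into Y is completed by a surjection from a complement of W onto a complement
of its image. -/
theorem exists_surjective_disjoint (W : Submodule K X)
    (h1 : Module.finrank K W ≤ Module.finrank K Y) (h2 : Module.finrank K Y ≤ Module.finrank K X) :
    ∃ ξ : X →ₗ[K] Y, Function.Surjective ξ ∧ Disjoint (LinearMap.ker ξ) W := by
  obtain ⟨j, hj⟩ := finrank_le_iff_exists_linearMap.mp h1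
  obtain ⟨D, hD⟩ := W.exists_isCompl
  obtain ⟨E, hE⟩ := (LinearMap.range j).exists_isCompl
  have e1 := Submodule.finrank_add_eq_of_isCompl hD
  have e2 := Submodule.finrank_add_eq_of_isCompl hE
  have e3 := LinearMap.finrank_range_of_inj hj
  obtain ⟨g, hg⟩ := exists_surjective_of_finrank_le (K := K) (X := D) (Y := E) (by omega)
  let pW := W.projectionOnto D hD
  let pD := D.projectionOnto W hD.symm
  have hpW : ∀ u : W, pW u = u := Submodule.projectionOnto_apply_left hD
  have hpWD : ∀ o : D, pW o = 0 := Submodule.projectionOnto_apply_right hD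
  have hpD : ∀ u : D, pD u = u := Submodule.projectionOnto_apply_left hD.symm
  have hpDW : ∀ u : W, pD u = 0 := Submodule.projectionOnto_apply_right hD.symm
  let ξ : X →ₗ[K] Y := j ∘ₗ pW + E.subtype ∘ₗ g ∘ₗ pD
  have hξW : ∀ w : W, ξ w = j w := fun w => by simp [ξ, hpW, hpDW]
  have hξD : ∀ d : D, ξ d = g d := fun d => by simp [ξ, hpD, hpWD]
  refine ⟨ξ, fun y => ?_, Submodule.disjoint_def.mpr fun x hx hxW => ?_⟩
  · have : y ∈ LinearMap.range j ⊔ E := by rw [hE.sup_eq_top]; trivial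
    obtain ⟨_, ⟨w, rfl⟩, e, he, rfl⟩ := Submodule.mem_sup.mp this
    obtain ⟨d, hd⟩ := hg ⟨e, he⟩
    refine ⟨w + d, ?_⟩
    rw [map_add, hξW, hξD, hd]
  · have h0 : j ⟨x, hxW⟩ = 0 := by rw [← hξW]; exact hx
    exact congrArg Subtype.val (hj (h0.trans (map_zero j).symm))

end Steps

/-! ### The Euclidean algorithm on dimensions -/

section Induction

universe u

variable {K : Type u} [Field K]

theorem isFrob_top_iff {V : Type*} [AddCommGroup V] [Module K V] [FiniteDimensional K V] :
    IsFrob (⊤ : Submodule K (Module.End K V)) ↔ Module.finrank K V = 0 := by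
  rw [Module.finrank_zero_iff]
  constructor
  · intro h
    by_contra hV
    rw [not_subsingleton_iff_nontrivial] at hV
    exact not_isFrob_of_central (z := (1 : Module.End K V)) Submodule.mem_top one_ne_zero
      (fun y _ => by rw [one_mul, mul_one]) h
  · intro hV
    exact ⟨0, fun x _ _ => LinearMap.ext fun v => Subsingleton.elim _ _⟩

theorem isFrob_quotExt_of_subsingleton {R : Type*} [Ring R] [Algebra K R] {V Y : Type*}
    [AddCommGroup V] [Module K V] [FiniteDimensional K V] [AddCommGroup Y] [Module K Y]
    [Subsingleton Y] (h : Submodule K R) (ρ : R →ₗ[K] Module.End K Y) (π : V →ₗ[K] Y) :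
    IsFrob (quotExt h ρ π) ↔ IsFrob h ∧ Module.finrank K V = 0 := by
  have : quotExt h ρ π = h.prod ⊤ := by
    ext p
    exact ⟨fun hp => ⟨hp.1, trivial⟩, fun hp => ⟨hp.1, fun v => Subsingleton.elim _ _⟩⟩
  rw [this, isFrob_prod, isFrob_top_iff]

theorem finrank_ker_of_leftInverse {V X : Type*} [AddCommGroup V] [Module K V] [AddCommGroup X]
    [Module K X] [FiniteDimensional K V] {i : X →ₗ[K] V} {q : V →ₗ[K] X}
    (hq : ∀ x, q (i x) = x) :
    Module.finrank K X + Module.finrank K (LinearMap.ker q) = Module.finrank K V := by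
  rw [← LinearMap.finrank_range_add_finrank_ker q,
    LinearMap.range_eq_top.mpr fun x => ⟨i x, hq x⟩, finrank_top]

theorem finrank_ker_of_surjective {V X : Type*} [AddCommGroup V] [Module K V] [AddCommGroup X]
    [Module K X] [FiniteDimensional K V] {q : V →ₗ[K] X} (hq : Function.Surjective q) :
    Module.finrank K X + Module.finrank K (LinearMap.ker q) = Module.finrank K V := by
  rw [← LinearMap.finrank_range_add_finrank_ker q, LinearMap.range_eq_top.mpr hq, finrank_top]

theorem exists_leftInverse {V X : Type*} [AddCommGroup V] [Module K V] [AddCommGroup X]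
    [Module K X] {i : X →ₗ[K] V} (hi : Function.Injective i) : ∃ q : V →ₗ[K] X, ∀ x, q (i x) = x := by
  obtain ⟨q, hq⟩ := i.exists_leftInverse_of_injective (LinearMap.ker_eq_bot.mpr hi)
  exact ⟨q, LinearMap.congr_fun hq⟩

theorem finrank_comap_mkQ {V : Type*} [AddCommGroup V] [Module K V] [FiniteDimensional K V]
    (W : Submodule K V) (Y : Submodule K (V ⧸ W)) :
    Module.finrank K (Y.comap W.mkQ) = Module.finrank K Y + Module.finrank K W := by
  have h1 := finrank_ker_of_surjective (q := Y.mkQ ∘ₗ W.mkQ)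
    (Y.mkQ_surjective.comp W.mkQ_surjective)
  rw [LinearMap.ker_comp, Submodule.ker_mkQ] at h1
  have h2 := Submodule.finrank_quotient_add_finrank Y
  have h3 := Submodule.finrank_quotient_add_finrank W
  omega

/-- The numerical criterion: `r` is the codimension of the tail, `g` a greatest common divisor. -/
def FrobCond (r g : ℕ) : Prop := (r = 1 ∧ g = 1) ∨ (r = 2 ∧ g = 1) ∨ (r = 3 ∧ g = 2)

/-- The criterion for both kinds of extensions, for all spaces of bounded size. -/
def CriterionUpTo (K : Type u) [Field K] (m : ℕ) : Prop :=
  (∀ {Z V : Type u} [AddCommGroup Z] [Module K Z] [FiniteDimensional K Z] [AddCommGroup V]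
    [Module K V] [FiniteDimensional K V] {W : Submodule K Z} {Q : LinearMap.BilinForm K Z}
    {π : V →ₗ[K] Z ⧸ W}, Q.IsSymm → NondegOn Q W → 1 ≤ Module.finrank K W →
    Function.Surjective π →
    -- Odd weights for quotient extensions and even ones for sub-extensions let the passage from the
    -- former to the latter decrease the weight even when ker π = 0 and the dimension stays the
    -- same.
    2 * (Module.finrank K (LinearMap.ker π) + Module.finrank K Z) + 1 < m →
    (IsFrob (quotExt (skewStab W Q) (quotRep W) π) ↔
      FrobCond (Module.finrank K W)
        (Int.gcd (Module.finrank K (LinearMap.ker π) + Module.finrank K Z)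
          (Module.finrank K Z - Module.finrank K W)))) ∧
  (∀ {X V : Type u} [AddCommGroup X] [Module K X] [FiniteDimensional K X] [AddCommGroup V]
    [Module K V] [FiniteDimensional K V] {W : Submodule K X} {Q : LinearMap.BilinForm K X}
    {i : X →ₗ[K] V}, Q.IsSymm → NondegOn Q W → 1 ≤ Module.finrank K W →
    Function.Injective i → 2 * Module.finrank K V < m →
    (IsFrob (subExt (skewStab W Q) i) ↔
      FrobCond (Module.finrank K W)
        (Int.gcd (Module.finrank K X)
          (Module.finrank K V - Module.finrank K X - Module.finrank K W))))

/-- In the associated `quotExt` the kernel of the structure map is U and dim Z = b, so the total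
dimension entering the gcd is dim V. -/
theorem isFrob_stab_disjoint_iff {m : ℕ} (ih : CriterionUpTo K m) {V : Type u} [AddCommGroup V]
    [Module K V] [FiniteDimensional K V] {U W : Submodule K V} {Q : LinearMap.BilinForm K V}
    (hQ : Q.IsSymm) (hW : NondegOn Q W) (hr : 1 ≤ Module.finrank K W) (hUW : Disjoint U W) {b : ℕ}
    (hb : Module.finrank K U + b = Module.finrank K V) (hm : 2 * Module.finrank K V + 1 < m) :
    IsFrob (stabSub U ⊓ skewStab W Q) ↔
      FrobCond (Module.finrank K W) (Int.gcd (Module.finrank K V) (b - Module.finrank K W)) := by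
  obtain ⟨Z, hWZ, hc⟩ := hUW.symm.exists_isCompl
  have hf := Submodule.finrank_add_eq_of_isCompl hc
  have hZ : Module.finrank K Z = b := by omega
  have hk := finrank_ker_of_surjective
    (LinearMap.snd_surjective (R := K) (M := U) (M₂ := Z ⧸ W.comap Z.subtype))
  rw [Module.finrank_prod] at hk
  have hW' := finrank_comap_subtype_of_le hWZ
  rw [isFrob_stab_of_disjoint Q hWZ hc.symm,
    ih.1 (restrict_isSymm hQ Z) (nondegOn_restrict_of_le hWZ hW) (by omega)
      LinearMap.snd_surjective (by omega), hW', hZ]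
  have e : (Module.finrank K (LinearMap.ker (LinearMap.snd K U (Z ⧸ W.comap Z.subtype))) + b : ℤ)
      = Module.finrank K V := by omega
  rw [e]

variable [CharZero K]

/-- Each injective step lowers dim V by dim X, which preserves its parity when dim X = 2. Once the
complement C is smaller than X, the algebra splits into orthogonal algebras of spaces of dimensions
dim X - dim C and dim C, and both must be at most 1. -/
theorem isFrob_subExt_skewStab_top {X : Type u} [AddCommGroup X] [Module K X]
    [FiniteDimensional K X] {Q : LinearMap.BilinForm K X} (hQ : Q.IsSymm) (hn : NondegOn Q ⊤)
    (hr : 1 ≤ Module.finrank K X) (d : ℕ) :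
    ∀ {V : Type u} [AddCommGroup V] [Module K V] [FiniteDimensional K V] {i : X →ₗ[K] V},
      Function.Injective i → Module.finrank K V = d →
      (IsFrob (subExt (skewStab ⊤ Q) i) ↔
        Module.finrank K X = 1 ∨ (Module.finrank K X = 2 ∧ Odd d)) := by
  induction d using Nat.strong_induction_on with
  | _ d ih =>
    intro V _ _ _ i hi hd
    obtain ⟨q, hq⟩ := exists_leftInverse hi
    have hC := finrank_ker_of_leftInverse hq
    rw [isFrob_subExt_skewStab hQ hn hq]
    by_cases hge : Module.finrank K X ≤ Module.finrank K (LinearMap.ker q)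
    · have hpar : Module.finrank K X = 2 → (Odd (Module.finrank K (LinearMap.ker q)) ↔ Odd d) := by
        intro h2
        rw [← hd, ← hC, h2, Nat.odd_add']
        simp [Nat.odd_iff]
      have hih : ∀ ξ : X →ₗ[K] LinearMap.ker q, Function.Injective ξ →
          (IsFrob (subExt (skewStab ⊤ Q) ξ) ↔
            Module.finrank K X = 1 ∨ (Module.finrank K X = 2 ∧ Odd d)) := fun ξ hξ => by
        rw [ih (Module.finrank K (LinearMap.ker q)) (by omega) hξ rfl]
        exact or_congr_right (and_congr_right hpar)
      constructor
      · rintro ⟨ξ, ⟨hξ, hf⟩ | ⟨hξ, -, hf⟩⟩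
        · exact (hih ξ hξ).mp hf
        · have hle := LinearMap.finrank_le_finrank_of_surjective hξ
          have hξ' : Function.Injective ξ :=
            (LinearMap.injective_iff_surjective_of_finrank_eq_finrank (by omega)).mpr hξ
          exact (hih ξ hξ').mp
            ((isFrob_subExt_of_surjective (commClosed_skewStab _ _) hξ).mpr hf)
      · intro h
        obtain ⟨ξ, hξ⟩ := finrank_le_iff_exists_linearMap.mp hge
        exact ⟨ξ, Or.inl ⟨hξ, (hih ξ hξ).mpr h⟩⟩
    · have hst : ∀ ξ : X →ₗ[K] LinearMap.ker q, Function.Surjective ξ →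
          NondegOn Q (LinearMap.ker ξ ⊓ ⊤) →
          (IsFrob (stabSub (LinearMap.ker ξ) ⊓ skewStab ⊤ Q) ↔
            Module.finrank K X = 1 ∨ (Module.finrank K X = 2 ∧ Odd d)) := fun ξ hξ hnd => by
        have hk := finrank_ker_of_surjective hξ
        rw [isFrob_stab_of_codisjoint hQ (by simp) hn hnd, Submodule.comap_top,
          isFrob_skewStab_top (restrict_isSymm hQ _)
            (by simpa using nondegOn_restrict hnd)]
        rw [Nat.odd_iff]
        omega
      constructor
      · rintro ⟨ξ, ⟨hξ, -⟩ | ⟨hξ, ho, hf⟩⟩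
        · exact absurd (LinearMap.finrank_le_finrank_of_injective hξ) hge
        · rcases ho with ho | ⟨-, ho⟩
          · have hk := finrank_ker_of_surjective hξ
            rw [disjoint_top] at ho
            rw [ho, finrank_bot] at hk
            omega
          · exact (hst ξ hξ ho).mp hf
      · intro h
        have h1 : Module.finrank K (LinearMap.ker q) ≤ 1 := by omega
        obtain ⟨ξ, h2, h3, h4⟩ := exists_surjective_nondegOn hQ hn (by simpa using hr) h1
        exact ⟨ξ, Or.inr ⟨h2, Or.inr ⟨h3, h4⟩, (hst ξ h2 h4).mpr h⟩⟩

theorem isFrob_skewStab {V : Type u} [AddCommGroup V] [Module K V] [FiniteDimensional K V]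
    {W : Submodule K V} {Q : LinearMap.BilinForm K V} (hQ : Q.IsSymm) (hW : NondegOn Q W)
    (hr : 1 ≤ Module.finrank K W) :
    IsFrob (skewStab W Q) ↔
      Module.finrank K W = 1 ∨ (Module.finrank K W = 2 ∧ Odd (Module.finrank K V)) := by
  have h1 : skewStab W Q = stabSub W ⊓ skewStab W Q :=
    (inf_eq_right.mpr fun _ hA => hA.1).symm
  rw [h1, isFrob_stab_of_le le_rfl, Submodule.comap_subtype_self]
  refine isFrob_subExt_skewStab_top (restrict_isSymm hQ W) ?_ hr _ W.subtype_injective rfl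
  have := nondegOn_restrict_of_le le_rfl hW
  rwa [Submodule.comap_subtype_self] at this

/-- Here r - b and n - b stand for dim (U ⊓ W) and dim U, and b ≤ 1 is the condition from the so(b)
factor. Either side forces r ≤ 3, leaving finitely many (r, b). Parity matters only through gcd(n,
2), for (r, b) = (2, 0) and (3, 1). -/
theorem frobCond_of_lt {n b r : ℕ} (hbr : b < r) (hbn : b ≤ n) :
    FrobCond r (Int.gcd n (b - r)) ↔
      (r - b = 1 ∨ (r - b = 2 ∧ Odd (n - b))) ∧ b ≤ 1 := by
  have hg : Int.gcd n (b - r) = Nat.gcd n (r - b) := by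
    rw [← Int.gcd_natCast_natCast, ← Int.gcd_neg]
    congr 1
    omega
  rw [hg]
  have h2 : Nat.gcd n 2 = if n % 2 = 0 then 2 else 1 := by
    split_ifs with h
    · exact Nat.gcd_eq_right (Nat.dvd_of_mod_eq_zero h)
    · exact Nat.coprime_two_right.mpr (Nat.odd_iff.mpr (by omega))
  have h3 : Nat.gcd n 3 ≠ 2 := fun h => by
    have : 2 ∣ 3 := h ▸ Nat.gcd_dvd_right n 3
    omega
  unfold FrobCond
  rw [Nat.odd_iff]
  by_cases hr : r ≤ 3
  · interval_cases r <;> interval_cases b <;> (simp_all; try omega)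
  · omega

theorem isFrob_stab_codisjoint_iff {V : Type u} [AddCommGroup V] [Module K V]
    [FiniteDimensional K V] {U W : Submodule K V} {Q : LinearMap.BilinForm K V} (hQ : Q.IsSymm)
    (hW : NondegOn Q W) (hUW : U ⊔ W = ⊤) (hM : NondegOn Q (U ⊓ W)) {b : ℕ}
    (hb : Module.finrank K U + b = Module.finrank K V) (hbr : b < Module.finrank K W) :
    IsFrob (stabSub U ⊓ skewStab W Q) ↔
      FrobCond (Module.finrank K W) (Int.gcd (Module.finrank K V) (b - Module.finrank K W)) := by
  have hd := Submodule.finrank_sup_add_finrank_inf_eq U W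
  rw [hUW, finrank_top] at hd
  have hc := finrank_comap_subtype (U := U) (W := W)
  rw [isFrob_stab_of_codisjoint hQ hUW hW hM, isFrob_skewStab (restrict_isSymm hQ U)
    (nondegOn_restrict hM) (by omega), frobCond_of_lt hbr (by omega), hc]
  have e1 : Module.finrank K ↥(U ⊓ W) = Module.finrank K W - b := by omega
  have e2 : Module.finrank K U = Module.finrank K V - b := by omega
  have e3 : Module.finrank K V ≤ Module.finrank K U + 1 ↔ b ≤ 1 := by omega
  rw [e3, e1, e2]

/-- A surjective ξ lowers dim ker π by dim Z - dim W. An injective ξ yields a subspace of Z of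
dimension dim ker π + dim W, to which the sub-extension criterion applies. Both are subtractions
that preserve the gcd. -/
theorem criterion_quotExt {m : ℕ} (ih : CriterionUpTo K m) {Z V : Type u} [AddCommGroup Z]
    [Module K Z] [FiniteDimensional K Z] [AddCommGroup V] [Module K V] [FiniteDimensional K V]
    {W : Submodule K Z} {Q : LinearMap.BilinForm K Z} {π : V →ₗ[K] Z ⧸ W} (hQ : Q.IsSymm)
    (hW : NondegOn Q W) (hr : 1 ≤ Module.finrank K W) (hπ : Function.Surjective π)
    (hm : 2 * (Module.finrank K (LinearMap.ker π) + Module.finrank K Z) + 1 ≤ m) :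
    IsFrob (quotExt (skewStab W Q) (quotRep W) π) ↔
      FrobCond (Module.finrank K W)
        (Int.gcd (Module.finrank K (LinearMap.ker π) + Module.finrank K Z)
          (Module.finrank K Z - Module.finrank K W)) := by
  have hY := Submodule.finrank_quotient_add_finrank W
  have hk := finrank_ker_of_surjective hπ
  by_cases h0 : Module.finrank K (Z ⧸ W) = 0
  -- The algebra is now so(Z) × gl(V), and the gcd degenerates to dim V + dim Z; both sides say dim
  -- Z = 1 and V = 0.
  · have hsub : Subsingleton (Z ⧸ W) := Module.finrank_zero_iff.mp h0
    have hWtop : W = ⊤ := Submodule.eq_top_of_finrank_eq (by omega)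
    rw [isFrob_quotExt_of_subsingleton]
    have e1 : (Module.finrank K Z - Module.finrank K W : ℤ) = 0 := by omega
    have e2 : IsFrob (skewStab W Q) ↔ Module.finrank K Z ≤ 1 := by
      rw [hWtop]
      exact isFrob_skewStab_top hQ (hWtop ▸ hW)
    rw [e1, e2, Int.gcd_zero_right, FrobCond]
    omega
  · rw [isFrob_quotExt_skewStab W Q hπ]
    by_cases hge : Module.finrank K (Z ⧸ W) ≤ Module.finrank K (LinearMap.ker π)
    · have hih : ∀ ξ : LinearMap.ker π →ₗ[K] Z ⧸ W, Function.Surjective ξ →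
          (IsFrob (quotExt (skewStab W Q) (quotRep W) ξ) ↔ FrobCond (Module.finrank K W)
            (Int.gcd (Module.finrank K (LinearMap.ker π) + Module.finrank K Z)
              (Module.finrank K Z - Module.finrank K W))) := fun ξ hξ => by
        have hkξ := finrank_ker_of_surjective hξ
        rw [ih.1 hQ hW hr hξ (by omega)]
        have e : (Module.finrank K (LinearMap.ker π) + Module.finrank K Z : ℤ) =
            (Module.finrank K (LinearMap.ker ξ) + Module.finrank K Z) +
              (Module.finrank K Z - Module.finrank K W) := by omega
        rw [e, Int.gcd_add_self_left]
      constructor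
      · rintro ⟨ξ, hξ, hf⟩
        refine (hih ξ ?_).mp hf
        rcases hξ with hξ | hξ
        · have := LinearMap.finrank_le_finrank_of_injective hξ
          exact (LinearMap.injective_iff_surjective_of_finrank_eq_finrank (by omega)).mp hξ
        · exact hξ
      · intro h
        obtain ⟨ξ, hξ⟩ := exists_surjective_of_finrank_le (K := K) hge
        exact ⟨ξ, Or.inr hξ, (hih ξ hξ).mpr h⟩
    · have hih : ∀ ξ : LinearMap.ker π →ₗ[K] Z ⧸ W, Function.Injective ξ →
          (IsFrob (quotExt (skewStab W Q) (quotRep W) ξ) ↔ FrobCond (Module.finrank K W)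
            (Int.gcd (Module.finrank K (LinearMap.ker π) + Module.finrank K Z)
              (Module.finrank K Z - Module.finrank K W))) := fun ξ hξ => by
        have hle : W ≤ (LinearMap.range ξ).comap W.mkQ := fun w hw => by
          have : W.mkQ w = 0 := by rwa [Submodule.mkQ_apply, Submodule.Quotient.mk_eq_zero]
          rw [Submodule.mem_comap, this]
          exact Submodule.zero_mem _
        have hX := finrank_comap_mkQ W (LinearMap.range ξ)
        rw [LinearMap.finrank_range_of_inj hξ] at hX
        have hW' := finrank_comap_subtype_of_le hle
        rw [isFrob_quotExt_of_injective (commClosed_skewStab W Q) quotRep_comm hξ, comap_mkQ_stab,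
          isFrob_stab_of_le hle, ih.2 (restrict_isSymm hQ _) (nondegOn_restrict_of_le hle hW)
            (by omega) (Submodule.subtype_injective _) (by omega), hW', hX]
        have e1 : (Module.finrank K (LinearMap.ker π) + Module.finrank K Z : ℤ) =
            ((Module.finrank K (LinearMap.ker π) + Module.finrank K W : ℕ) : ℤ) +
              (Module.finrank K Z - Module.finrank K W) := by omega
        have e2 : (Module.finrank K Z - ((Module.finrank K (LinearMap.ker π) +
            Module.finrank K W : ℕ) : ℤ) - Module.finrank K W : ℤ) =
            (Module.finrank K Z - Module.finrank K W) -
            ((Module.finrank K (LinearMap.ker π) + Module.finrank K W : ℕ) : ℤ) := by omega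
        rw [e1, e2, Int.gcd_add_self_left, Int.gcd_sub_self_right]
      constructor
      · rintro ⟨ξ, hξ, hf⟩
        refine (hih ξ ?_).mp hf
        rcases hξ with hξ | hξ
        · exact hξ
        · exact absurd (LinearMap.finrank_le_finrank_of_surjective hξ) hge
      · intro h
        obtain ⟨ξ, hξ⟩ := finrank_le_iff_exists_linearMap.mp (le_of_not_ge hge)
        exact ⟨ξ, Or.inl hξ, (hih ξ hξ).mpr h⟩

/-- With C a complement of X, the gcd is that of dim X and dim C - r. An injective ξ : X → C
subtracts dim X from dim C. A surjective one gives the stabilizer of (ker ξ, W) inside X with b =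
dim C, which leaves the pair of numbers unchanged. -/
theorem criterion_subExt {m : ℕ} (ih : CriterionUpTo K m) {X V : Type u} [AddCommGroup X]
    [Module K X] [FiniteDimensional K X] [AddCommGroup V] [Module K V] [FiniteDimensional K V]
    {W : Submodule K X} {Q : LinearMap.BilinForm K X} {i : X →ₗ[K] V} (hQ : Q.IsSymm)
    (hW : NondegOn Q W) (hr : 1 ≤ Module.finrank K W) (hi : Function.Injective i)
    (hm : 2 * Module.finrank K V ≤ m) :
    IsFrob (subExt (skewStab W Q) i) ↔
      FrobCond (Module.finrank K W)
        (Int.gcd (Module.finrank K X)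
          (Module.finrank K V - Module.finrank K X - Module.finrank K W)) := by
  obtain ⟨q, hq⟩ := exists_leftInverse hi
  have hC := finrank_ker_of_leftInverse hq
  have hWX := W.finrank_le
  have hC' : (Module.finrank K V - Module.finrank K X : ℤ) =
      Module.finrank K (LinearMap.ker q) := by omega
  rw [isFrob_subExt_skewStab hQ hW hq, hC']
  by_cases hge : Module.finrank K X ≤ Module.finrank K (LinearMap.ker q)
  · have hih : ∀ ξ : X →ₗ[K] LinearMap.ker q, Function.Injective ξ →
        (IsFrob (subExt (skewStab W Q) ξ) ↔ FrobCond (Module.finrank K W)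
          (Int.gcd (Module.finrank K X)
            (Module.finrank K (LinearMap.ker q) - Module.finrank K W))) := fun ξ hξ => by
      rw [ih.2 hQ hW hr hξ (by omega), sub_right_comm, Int.gcd_sub_self_right]
    constructor
    · rintro ⟨ξ, ⟨hξ, hf⟩ | ⟨hξ, -, hf⟩⟩
      · exact (hih ξ hξ).mp hf
      · have hle := LinearMap.finrank_le_finrank_of_surjective hξ
        have hξ' : Function.Injective ξ :=
          (LinearMap.injective_iff_surjective_of_finrank_eq_finrank (by omega)).mpr hξ
        exact (hih ξ hξ').mp
          ((isFrob_subExt_of_surjective (commClosed_skewStab _ _) hξ).mpr hf)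
    · intro h
      obtain ⟨ξ, hξ⟩ := finrank_le_iff_exists_linearMap.mp hge
      exact ⟨ξ, Or.inl ⟨hξ, (hih ξ hξ).mpr h⟩⟩
  by_cases hrb : Module.finrank K W ≤ Module.finrank K (LinearMap.ker q)
  · have hst : ∀ ξ : X →ₗ[K] LinearMap.ker q, Function.Surjective ξ →
        Disjoint (LinearMap.ker ξ) W →
        (IsFrob (stabSub (LinearMap.ker ξ) ⊓ skewStab W Q) ↔ FrobCond (Module.finrank K W)
          (Int.gcd (Module.finrank K X)
            (Module.finrank K (LinearMap.ker q) - Module.finrank K W))) := fun ξ hξ hd => by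
      have hk := finrank_ker_of_surjective hξ
      exact isFrob_stab_disjoint_iff ih hQ hW hr hd (by omega) (by omega)
    constructor
    · rintro ⟨ξ, ⟨hξ, -⟩ | ⟨hξ, ho, hf⟩⟩
      · exact absurd (LinearMap.finrank_le_finrank_of_injective hξ) hge
      · refine (hst ξ hξ ?_).mp hf
        rcases ho with ho | ⟨ho, -⟩
        · exact ho
        -- As dim W ≤ dim C = codim ker ξ, spanning together with W leaves no room for an
        -- intersection, so this case is disjoint too.
        · have hk := finrank_ker_of_surjective hξ
          have hs := Submodule.finrank_sup_add_finrank_inf_eq (LinearMap.ker ξ) W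
          rw [ho, finrank_top] at hs
          rw [disjoint_iff, ← Submodule.finrank_eq_zero (R := K)]
          omega
    · intro h
      obtain ⟨ξ, h1, h2⟩ := exists_surjective_disjoint (K := K) W hrb (le_of_not_ge hge)
      exact ⟨ξ, Or.inr ⟨h1, Or.inl h2, (hst ξ h1 h2).mpr h⟩⟩
  · have hst : ∀ ξ : X →ₗ[K] LinearMap.ker q, Function.Surjective ξ →
        LinearMap.ker ξ ⊔ W = ⊤ → NondegOn Q (LinearMap.ker ξ ⊓ W) →
        (IsFrob (stabSub (LinearMap.ker ξ) ⊓ skewStab W Q) ↔ FrobCond (Module.finrank K W)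
          (Int.gcd (Module.finrank K X)
            (Module.finrank K (LinearMap.ker q) - Module.finrank K W))) := fun ξ hξ hs hn => by
      have hk := finrank_ker_of_surjective hξ
      exact isFrob_stab_codisjoint_iff hQ hW hs hn (by omega) (by omega)
    constructor
    · rintro ⟨ξ, ⟨hξ, -⟩ | ⟨hξ, ho, hf⟩⟩
      · exact absurd (LinearMap.finrank_le_finrank_of_injective hξ) hge
      · rcases ho with ho | ⟨ho, hn⟩
        · have hk := finrank_ker_of_surjective hξ
          have hs := Submodule.finrank_sup_add_finrank_inf_eq (LinearMap.ker ξ) W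
          rw [disjoint_iff.mp ho, finrank_bot] at hs
          have := (LinearMap.ker ξ ⊔ W).finrank_le
          omega
        · exact (hst ξ hξ ho hn).mp hf
    · intro h
      -- The criterion itself gives dim C ≤ 1, the range in which a hyperplane witness is available.
      have h1 := ((frobCond_of_lt (lt_of_not_ge hrb) (le_of_not_ge hge)).mp h).2
      obtain ⟨ξ, h2, h3, h4⟩ := exists_surjective_nondegOn hQ hW hr h1
      exact ⟨ξ, Or.inr ⟨h2, Or.inr ⟨h3, h4⟩, (hst ξ h2 h3 h4).mpr h⟩⟩

theorem criterionUpTo (m : ℕ) : CriterionUpTo K m := by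
  induction m with
  | zero => exact ⟨fun _ _ _ _ h => absurd h (by omega), fun _ _ _ _ h => absurd h (by omega)⟩
  | succ m ih =>
    exact ⟨fun h1 h2 h3 h4 h5 => criterion_quotExt ih h1 h2 h3 h4 (by omega),
      fun h1 h2 h3 h4 h5 => criterion_subExt ih h1 h2 h3 h4 (by omega)⟩

end Induction

/-! ### The seaweed as a semidirect product with Sym²W -/

section SeaweedReduction

attribute [local instance 100] LieRing.ofAssociativeRing

variable {K : Type*} [Field K]

/-- An infimum of natural numbers is attained, and functionals on the subalgebra extend to the
ambient associative algebra. -/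
theorem index_eq_zero_iff {R : Type*} [Ring R] [Algebra K R] [FiniteDimensional K R]
    (S : LieSubalgebra K R) : index K S = 0 ↔ IsFrob S.toSubmodule := by
  have hbr : ∀ x y : S, ((⁅x, y⁆ : S) : R) = x * y - y * x := fun x y => by
    rw [LieSubalgebra.coe_bracket, LieRing.of_associative_ring_bracket]
  have h0 : index K S = 0 ↔ ∃ f : Module.Dual K S,
      Module.finrank K (LinearMap.ker (kirillovForm K S f)) = 0 := by
    rw [index, iInf, Nat.sInf_eq_zero]
    constructor
    · rintro (⟨f, hf⟩ | h)
      · exact ⟨f, hf⟩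
      · exact absurd h (Set.range_nonempty _).ne_empty
    · rintro ⟨f, hf⟩
      exact Or.inl ⟨f, hf⟩
  rw [h0]
  constructor
  · rintro ⟨f, hf⟩
    rw [Submodule.finrank_eq_zero, LinearMap.ker_eq_bot'] at hf
    obtain ⟨g, hg⟩ := f.exists_extend
    have hg' : ∀ x : S, g x = f x := fun x => LinearMap.congr_fun hg x
    refine ⟨g, fun x hx h => ?_⟩
    have := hf ⟨x, hx⟩ (LinearMap.ext fun y => by
      change f ⁅(⟨x, hx⟩ : S), y⁆ = 0
      rw [← hg', hbr]
      exact h y y.2)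
    exact congrArg Subtype.val this
  · rintro ⟨g, hg⟩
    refine ⟨g ∘ₗ S.toSubmodule.subtype, ?_⟩
    rw [Submodule.finrank_eq_zero, LinearMap.ker_eq_bot']
    refine fun x hx => Subtype.ext (hg x x.2 fun y hy => ?_)
    have := LinearMap.congr_fun hx ⟨y, hy⟩
    change g ((⁅x, (⟨y, hy⟩ : S)⁆ : S) : R) = 0 at this
    rwa [hbr] at this

/-- The partial sum a + b = n makes the span of the first n basis vectors invariant, which kills the
lower left block. -/
theorem mem_seaweed_iff {n a b c : ℕ} (hb : 0 < b) (hab : a + b = n) (hcn : c ≤ n)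
    (X : Matrix (Fin n ⊕ Fin n) (Fin n ⊕ Fin n) K) :
    X ∈ seaweed K n [a, b] [c] ↔
      (∀ i j : Fin n, (j : ℕ) < a → a ≤ i → X (.inl i) (.inl j) = 0) ∧
      (∀ i j : Fin n, (i : ℕ) < c → c ≤ j → X (.inl i) (.inl j) = 0) ∧
      (∀ i j, X (.inr i) (.inl j) = 0) ∧ (∀ i j, X (.inr i) (.inr j) = -X (.inl j) (.inl i)) ∧
      (∀ i j, X (.inl i) (.inr j) = X (.inl j) (.inr i)) ∧
      (∀ i j : Fin n, (i : ℕ) < c → X (.inl i) (.inr j) = 0) := by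
  have hab' : simpleRootsOf [a, b] = {a, n} := by
    ext k
    simp only [simpleRootsOf, Set.mem_ofPred_eq, Set.mem_insert_iff, Set.mem_singleton_iff,
      List.length_cons, List.length_nil]
    constructor
    · rintro ⟨m, h1, h2, rfl⟩
      interval_cases m <;> simp [hab]
    · rintro (rfl | rfl)
      · exact ⟨1, by simp⟩
      · exact ⟨2, by simp [hab]⟩
  have hc' : simpleRootsOf [c] = {c} := by
    ext k
    simp only [simpleRootsOf, Set.mem_ofPred_eq, Set.mem_singleton_iff,
      List.length_cons, List.length_nil]
    constructor
    · rintro ⟨m, h1, h2, rfl⟩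
      interval_cases m
      simp
    · rintro rfl
      exact ⟨1, by simp⟩
  have hp : ∀ i : Fin n, n ≤ pos n (.inr i) := fun i => by
    have := i.isLt
    simp only [pos]
    omega
  have hl : ∀ i : Fin n, pos n (.inl i) = i := fun i => rfl
  rw [seaweed, LieSubalgebra.mem_inf, mem_parabolic, mem_oppParabolic, hab', hc', mem_sp_iff]
  simp only [Set.mem_insert_iff, Set.mem_singleton_iff, forall_eq_or_imp, forall_eq]
  constructor
  · rintro ⟨⟨⟨h1, h2, h3⟩, h4, h5⟩, -, h6⟩
    refine ⟨fun i j hj hi => h4 _ _ hj hi, fun i j hi hj => h6 _ _ hi hj,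
      fun i j => h5 _ _ j.isLt (hp i), fun i j => congrFun (congrFun h1 i) j,
      fun i j => congrFun (congrFun h2 j) i, fun i j hi => h6 _ _ hi (hcn.trans (hp j))⟩
  · rintro ⟨h1, h2, h3, h4, h5, h6⟩
    have hsp : X.toBlocks₂₂ = -X.toBlocks₁₁.transpose ∧ X.toBlocks₁₂.IsSymm ∧
        X.toBlocks₂₁.IsSymm :=
      ⟨Matrix.ext h4, Matrix.ext fun i j => h5 j i, Matrix.ext fun i j => by
        change X (.inr j) (.inl i) = X (.inr i) (.inl j)
        rw [h3, h3]⟩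
    refine ⟨⟨hsp, ?_, ?_⟩, hsp, ?_⟩
    · rintro (i | i) (j | j) hj hi
      · exact h1 i j hj hi
      · have := hp j
        omega
      · exact h3 i j
      · have := hp j
        omega
    · rintro (i | i) (j | j) hj hi
      · have := i.isLt
        rw [hl] at hi
        omega
      · have := hp j
        omega
      · exact h3 i j
      · have := hp j
        omega
    · rintro (i | i) (j | j) hi hj
      · exact h2 i j hi hj
      · exact h6 i j hi
      · have := hp i
        omega
      · have := hp i
        omega

/-- The span of the first `a` basis vectors of `Kⁿ`. -/
def firstCoords (K : Type*) [Field K] (n a : ℕ) : Submodule K (Fin n → K) where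
  carrier := {v | ∀ i : Fin n, a ≤ i → v i = 0}
  add_mem' := fun hv hw i hi => by rw [Pi.add_apply, hv i hi, hw i hi, add_zero]
  zero_mem' := fun _ _ => rfl
  smul_mem' := fun t v hv i hi => by rw [Pi.smul_apply, hv i hi, smul_zero]

/-- The span of all but the first `c` basis vectors of `Kⁿ`. -/
def lastCoords (K : Type*) [Field K] (n c : ℕ) : Submodule K (Fin n → K) where
  carrier := {v | ∀ i : Fin n, (i : ℕ) < c → v i = 0}
  add_mem' := fun hv hw i hi => by rw [Pi.add_apply, hv i hi, hw i hi, add_zero]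
  zero_mem' := fun _ _ => rfl
  smul_mem' := fun t v hv i hi => by rw [Pi.smul_apply, hv i hi, smul_zero]

theorem finrank_lastCoords {n c : ℕ} (hcn : c ≤ n) :
    c + Module.finrank K (lastCoords K n c) = n := by
  have h := finrank_ker_of_surjective
    (LinearMap.funLeft_surjective_of_injective K K _ (Fin.castLE_injective hcn))
  have e : LinearMap.ker (LinearMap.funLeft K K (Fin.castLE hcn)) = lastCoords K n c := by
    ext v
    rw [LinearMap.mem_ker]
    constructor
    · exact fun hv i hi => congrFun hv ⟨i, hi⟩
    · exact fun hv => funext fun i => hv (Fin.castLE hcn i) i.isLt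
  rwa [e, Module.finrank_fin_fun, Module.finrank_fin_fun] at h

theorem finrank_firstCoords {n a b : ℕ} (hab : a + b = n) :
    Module.finrank K (firstCoords K n a) + b = n := by
  subst hab
  have h := finrank_ker_of_surjective
    (LinearMap.funLeft_surjective_of_injective K K _ (Fin.natAdd_injective b a))
  have e : LinearMap.ker (LinearMap.funLeft K K (Fin.natAdd a : Fin b → Fin (a + b))) =
      firstCoords K (a + b) a := by
    ext v
    rw [LinearMap.mem_ker]
    constructor
    · intro hv i hi
      have := congrFun hv ⟨i - a, by have := i.isLt; omega⟩
      rw [LinearMap.funLeft_apply] at this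
      have e : (Fin.natAdd a ⟨i - a, by have := i.isLt; omega⟩ : Fin (a + b)) = i :=
        Fin.ext (by rw [Fin.val_natAdd]; dsimp only; omega)
      rwa [e] at this
    · exact fun hv => funext fun i => hv (Fin.natAdd a i) (by simp)
  rw [e, Module.finrank_fin_fun, Module.finrank_fin_fun] at h
  omega

theorem single_mem_firstCoords {n a : ℕ} {j : Fin n} (hj : (j : ℕ) < a) (t : K) :
    Pi.single j t ∈ firstCoords K n a := fun i hi => by
  rw [Pi.single_eq_of_ne]
  rintro rfl
  omega

theorem single_mem_lastCoords {n c : ℕ} {j : Fin n} (hj : c ≤ j) (t : K) :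
    Pi.single j t ∈ lastCoords K n c := fun i hi => by
  rw [Pi.single_eq_of_ne]
  rintro rfl
  omega

theorem disjoint_firstCoords_lastCoords {n a c : ℕ} (h : a ≤ c) :
    Disjoint (firstCoords K n a) (lastCoords K n c) :=
  Submodule.disjoint_def.mpr fun v h1 h2 => funext fun i => by
    rcases lt_or_ge (i : ℕ) c with hi | hi
    · exact h2 i hi
    · exact h1 i (h.trans hi)

theorem firstCoords_sup_lastCoords {n a c : ℕ} (h : c ≤ a) :
    firstCoords K n a ⊔ lastCoords K n c = ⊤ := by
  rw [eq_top_iff]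
  intro v _
  refine Submodule.mem_sup.mpr ⟨fun i => if (i : ℕ) < c then v i else 0, fun i hi => ?_,
    fun i => if (i : ℕ) < c then 0 else v i, fun i hi => if_pos hi, funext fun i => ?_⟩
  · exact if_neg (by omega)
  · simp only [Pi.add_apply]
    split_ifs <;> simp

/-- Symmetric matrices supported on the indices from `c` on. -/
def symmTail (K : Type*) [Field K] (n c : ℕ) : Submodule K (Matrix (Fin n) (Fin n) K) where
  carrier := {B | (∀ i j, B i j = B j i) ∧ ∀ i j : Fin n, (i : ℕ) < c → B i j = 0}
  add_mem' := fun hB hC => ⟨fun i j => by rw [Matrix.add_apply, Matrix.add_apply, hB.1, hC.1],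
    fun i j hi => by rw [Matrix.add_apply, hB.2 i j hi, hC.2 i j hi, add_zero]⟩
  zero_mem' := ⟨fun _ _ => rfl, fun _ _ _ => rfl⟩
  smul_mem' := fun t B hB => ⟨fun i j => by rw [Matrix.smul_apply, Matrix.smul_apply, hB.1],
    fun i j hi => by rw [Matrix.smul_apply, hB.2 i j hi, smul_zero]⟩

/-- The projection of `Kⁿ` onto the coordinates from `c` on. -/
def tailProj (K : Type*) [Field K] (n c : ℕ) : Module.End K (Fin n → K) where
  toFun v i := if (i : ℕ) < c then 0 else v i
  map_add' v w := funext fun i => by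
    simp only [Pi.add_apply]
    split_ifs <;> simp
  map_smul' t v := funext fun i => by simp

theorem tailProj_mem {n c : ℕ} (v : Fin n → K) : tailProj K n c v ∈ lastCoords K n c :=
  fun _ hi => if_pos hi

theorem tailProj_eq {n c : ℕ} {v : Fin n → K} (hv : v ∈ lastCoords K n c) :
    tailProj K n c v = v := funext fun i => by
  by_cases hi : (i : ℕ) < c
  · exact (if_pos hi).trans (hv i hi).symm
  · exact if_neg hi

/-- The symmetric product `v wᵀ + w vᵀ` of the tails of two vectors. -/
def symmProd (K : Type*) [Field K] (n c : ℕ) :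
    (Fin n → K) →ₗ[K] (Fin n → K) →ₗ[K] symmTail K n c :=
  -- Projecting to the tail first makes the product bilinear on all of Kⁿ with values in Sym²W; on W
  -- the projection is the identity.
  LinearMap.mk₂ K (fun v w => ⟨Matrix.of fun i j => tailProj K n c v i * tailProj K n c w j +
      tailProj K n c w i * tailProj K n c v j, fun i j => by simp only [Matrix.of_apply]; ring,
      fun i j hi => by
        rw [Matrix.of_apply, tailProj_mem v i hi, tailProj_mem w i hi]; ring⟩)
    (fun v v' w => Subtype.ext (Matrix.ext fun i j => by
      simp only [map_add, Pi.add_apply, Submodule.coe_add,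
        Matrix.add_apply, Matrix.of_apply]
      ring))
    (fun t v w => Subtype.ext (Matrix.ext fun i j => by
      simp only [map_smul, Pi.smul_apply, Submodule.coe_smul, Matrix.smul_apply, Matrix.of_apply,
        smul_eq_mul]
      ring))
    (fun v w w' => Subtype.ext (Matrix.ext fun i j => by
      simp only [map_add, Pi.add_apply, Submodule.coe_add,
        Matrix.add_apply, Matrix.of_apply]
      ring))
    (fun t v w => Subtype.ext (Matrix.ext fun i j => by
      simp only [map_smul, Pi.smul_apply, Submodule.coe_smul, Matrix.smul_apply, Matrix.of_apply,
        smul_eq_mul]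
      ring))

theorem symmProd_apply {n c : ℕ} {v w : Fin n → K} (hv : v ∈ lastCoords K n c)
    (hw : w ∈ lastCoords K n c) (i j : Fin n) :
    (symmProd K n c v w : Matrix (Fin n) (Fin n) K) i j = v i * w j + w i * v j := by
  change tailProj K n c v i * tailProj K n c w j + tailProj K n c w i * tailProj K n c v j = _
  rw [tailProj_eq hv, tailProj_eq hw]

theorem symmProd_comm {n c : ℕ} (v w : Fin n → K) :
    symmProd K n c v w = symmProd K n c w v :=
  Subtype.ext (Matrix.ext fun _ _ => add_comm _ _)

/-- The action of `Kⁿ`-endomorphisms on symmetric tensors of the tail. -/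
def symmAct (K : Type*) [Field K] (n c : ℕ) :
    Module.End K (Fin n → K) →ₗ[K] symmTail K n c →ₗ[K] symmTail K n c :=
  -- This is A B + (A B)ᵀ, with a projection that keeps the values in `symmTail` for every A and
  -- does nothing when A preserves W.
  LinearMap.mk₂ K (fun A B => ⟨Matrix.of fun i j => tailProj K n c (A fun k => B.1 k j) i +
      tailProj K n c (A fun k => B.1 k i) j, fun i j => add_comm _ _, fun i j hi => by
        have h0 : (fun k => B.1 k i) = 0 := funext fun k => by rw [B.2.1, B.2.2 i k hi]; rfl
        rw [Matrix.of_apply, tailProj_mem _ i hi, h0]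
        simp⟩)
    (fun A A' B => Subtype.ext (Matrix.ext fun i j => by
      simp only [LinearMap.add_apply, map_add, Pi.add_apply, Submodule.coe_add,
        Matrix.add_apply, Matrix.of_apply]
      ring))
    (fun t A B => Subtype.ext (Matrix.ext fun i j => by
      simp only [LinearMap.smul_apply, map_smul, Pi.smul_apply, Submodule.coe_smul,
        Matrix.smul_apply, Matrix.of_apply, smul_eq_mul]
      ring))
    (fun A B B' => Subtype.ext (Matrix.ext fun i j => by
      have h : ∀ l, (fun k => (B + B').1 k l) = (fun k => B.1 k l) + fun k => B'.1 k l :=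
        fun l => rfl
      simp only [Matrix.of_apply, h]
      simp only [map_add, Pi.add_apply, Submodule.coe_add,
        Matrix.add_apply, Matrix.of_apply]
      ring))
    (fun t A B => Subtype.ext (Matrix.ext fun i j => by
      have h : ∀ l, (fun k => (t • B).1 k l) = t • fun k => B.1 k l := fun l => rfl
      simp only [Matrix.of_apply, h]
      simp only [map_smul, Pi.smul_apply, Submodule.coe_smul, Matrix.smul_apply, Matrix.of_apply,
        smul_eq_mul]
      ring))

theorem col_mem_lastCoords {n c : ℕ} (B : symmTail K n c) (j : Fin n) :
    (fun k => B.1 k j) ∈ lastCoords K n c := fun i hi => B.2.2 i j hi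

theorem symmAct_apply {n c : ℕ} {A : Module.End K (Fin n → K)}
    (hA : A ∈ stabSub (lastCoords K n c)) (B : symmTail K n c) (i j : Fin n) :
    (symmAct K n c A B : Matrix (Fin n) (Fin n) K) i j =
      A (fun k => B.1 k j) i + A (fun k => B.1 k i) j := by
  change tailProj K n c (A fun k => B.1 k j) i + tailProj K n c (A fun k => B.1 k i) j = _
  rw [tailProj_eq (hA _ (col_mem_lastCoords B j)), tailProj_eq (hA _ (col_mem_lastCoords B i))]

theorem symmAct_symmProd {n c : ℕ} {A : Module.End K (Fin n → K)}
    (hA : A ∈ stabSub (lastCoords K n c)) {v w : Fin n → K} (hv : v ∈ lastCoords K n c)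
    (hw : w ∈ lastCoords K n c) :
    symmAct K n c A (symmProd K n c v w) = symmProd K n c (A v) w + symmProd K n c v (A w) := by
  have hcol : ∀ j, (fun k => (symmProd K n c v w).1 k j) = w j • v + v j • w := fun j =>
    funext fun k => by
      rw [symmProd_apply hv hw]
      simp only [Pi.add_apply, Pi.smul_apply, smul_eq_mul]
      ring
  refine Subtype.ext (Matrix.ext fun i j => ?_)
  rw [symmAct_apply hA, Submodule.coe_add, Matrix.add_apply, symmProd_apply (hA v hv) hw,
    symmProd_apply hv (hA w hw), hcol, hcol]
  simp only [map_add, map_smul, Pi.add_apply, Pi.smul_apply, smul_eq_mul]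
  ring

/-- The blocks diag(A, -Aᵀ) form the acting algebra, the upper right block B the abelian ideal, and
the bracket of the two is A B + B Aᵀ. -/
theorem isFrob_seaweed_iff {n a b c : ℕ} (hb : 0 < b) (hab : a + b = n) (hcn : c ≤ n) :
    IsFrob (seaweed K n [a, b] [c]).toSubmodule ↔ ∃ ξ : symmTail K n c →ₗ[K] K,
      (∀ B, (∀ A ∈ stabSub (firstCoords K n a) ⊓ stabSub (lastCoords K n c),
        ξ (symmAct K n c A B) = 0) → B = 0) ∧
      IsFrob (stabFunctional (stabSub (firstCoords K n a) ⊓ stabSub (lastCoords K n c))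
        (symmAct K n c) ξ) := by
  let ι : Module.End K (Fin n → K) →ₗ[K] Matrix (Fin n ⊕ Fin n) (Fin n ⊕ Fin n) K :=
    { toFun := fun A => Matrix.fromBlocks (LinearMap.toMatrix' A) 0 0
        (-(LinearMap.toMatrix' A).transpose)
      map_add' := fun A A' => by
        rw [Matrix.fromBlocks_add, map_add, Matrix.transpose_add, neg_add, add_zero]
      map_smul' := fun t A => by
        rw [RingHom.id_apply, Matrix.fromBlocks_smul, map_smul, Matrix.transpose_smul, smul_neg,
          smul_zero] }
  let κ : symmTail K n c →ₗ[K] Matrix (Fin n ⊕ Fin n) (Fin n ⊕ Fin n) K :=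
    { toFun := fun B => Matrix.fromBlocks 0 B.1 0 0
      map_add' := fun A A' => by
        rw [Matrix.fromBlocks_add, Submodule.coe_add, add_zero]
      map_smul' := fun t A => by
        rw [RingHom.id_apply, Matrix.fromBlocks_smul, Submodule.coe_smul, smul_zero] }
  have hι : ∀ A, ι A = Matrix.fromBlocks (LinearMap.toMatrix' A) 0 0
        (-(LinearMap.toMatrix' A).transpose) := fun _ => rfl
  have hκ : ∀ B, κ B = Matrix.fromBlocks 0 B.1 0 0 := fun _ => rfl
  refine isFrob_semidirect ι κ (symmAct K n c)
    (commClosed_inf (commClosed_stabSub _) (commClosed_stabSub _)) ?_ ?_ ?_ ?_ ?_ ?_ ?_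
  · rintro A ⟨hU, hW⟩
    refine (mem_seaweed_iff hb hab hcn _).mpr ⟨fun i j hj hi => ?_, fun i j hi hj => ?_,
      fun _ _ => rfl, fun _ _ => rfl, fun _ _ => rfl, fun _ _ _ => rfl⟩
    · change LinearMap.toMatrix' A i j = 0
      rw [LinearMap.toMatrix'_apply]
      exact hU _ (single_mem_firstCoords hj 1) i hi
    · change LinearMap.toMatrix' A i j = 0
      rw [LinearMap.toMatrix'_apply]
      exact hW _ (single_mem_lastCoords hj 1) i hi
  · intro B
    exact (mem_seaweed_iff hb hab hcn _).mpr ⟨fun _ _ _ _ => rfl, fun _ _ _ _ => rfl,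
      fun _ _ => rfl, fun _ _ => neg_zero.symm, B.2.1, B.2.2⟩
  · intro X hX
    obtain ⟨h1, h2, h3, h4, h5, h6⟩ := (mem_seaweed_iff hb hab hcn X).mp hX
    refine ⟨Matrix.toLin' X.toBlocks₁₁, ⟨fun v hv i hi => ?_, fun v hv i hi => ?_⟩,
      ⟨X.toBlocks₁₂, h5, h6⟩, ?_⟩
    · rw [Matrix.toLin'_apply, Matrix.mulVec, dotProduct]
      refine Finset.sum_eq_zero fun j _ => ?_
      rcases lt_or_ge (j : ℕ) a with hj | hj
      · exact mul_eq_zero_of_left (h1 i j hj hi) _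
      · exact mul_eq_zero_of_right _ (hv j hj)
    · rw [Matrix.toLin'_apply, Matrix.mulVec, dotProduct]
      refine Finset.sum_eq_zero fun j _ => ?_
      rcases lt_or_ge (j : ℕ) c with hj | hj
      · exact mul_eq_zero_of_right _ (hv j hj)
      · exact mul_eq_zero_of_left (h2 i j hi hj) _
    · rw [hι, hκ, LinearMap.toMatrix'_toLin', Matrix.fromBlocks_add]
      simp only [add_zero, zero_add]
      conv_lhs => rw [← Matrix.fromBlocks_toBlocks X]
      congr 1
      · exact Matrix.ext h3
      · exact Matrix.ext h4
  · intro A _ B h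
    rw [hι, hκ, Matrix.fromBlocks_add, ← Matrix.fromBlocks_zero, Matrix.fromBlocks_inj] at h
    simp only [add_zero, zero_add] at h
    exact ⟨(LinearEquiv.map_eq_zero_iff _).mp h.1, Subtype.ext h.2.1⟩
  · intro A _ A' _
    have e : LinearMap.toMatrix' (A * A' - A' * A) =
        LinearMap.toMatrix' A * LinearMap.toMatrix' A' +
          -(LinearMap.toMatrix' A' * LinearMap.toMatrix' A) := by
      rw [map_sub, LinearMap.toMatrix'_mul, LinearMap.toMatrix'_mul, sub_eq_add_neg]
    rw [hι (A * A' - A' * A), e]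
    simp only [hι, Matrix.fromBlocks_multiply, Matrix.transpose_add, Matrix.transpose_neg,
      Matrix.transpose_mul, mul_zero, zero_mul, add_zero, zero_add, neg_mul_neg, sub_eq_add_neg,
      Matrix.fromBlocks_neg, Matrix.fromBlocks_add, neg_zero, neg_add, neg_neg]
    congr 1
    abel
  · rintro A ⟨-, hW⟩ B
    simp only [hι, hκ, Matrix.fromBlocks_multiply, mul_zero, zero_mul, add_zero, zero_add,
      sub_eq_add_neg, Matrix.fromBlocks_neg, Matrix.fromBlocks_add, neg_zero, mul_neg, neg_neg]
    congr 1
    refine Matrix.ext fun i j => ?_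
    have hmul : ∀ i j, (LinearMap.toMatrix' A * B.1) i j = A (fun k => B.1 k j) i := fun i j => by
      conv_rhs => rw [← Matrix.toLin'_toMatrix' A]
      rfl
    have hmul' : (B.1 * (LinearMap.toMatrix' A).transpose) i j =
        (LinearMap.toMatrix' A * B.1) j i := by
      rw [Matrix.mul_apply, Matrix.mul_apply]
      exact Finset.sum_congr rfl fun k _ => by rw [Matrix.transpose_apply, B.2.1 i k, mul_comm]
    rw [symmAct_apply hW, Matrix.add_apply, hmul', hmul, hmul]
  · intro B B'
    simp [hκ, Matrix.fromBlocks_multiply]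

end SeaweedReduction

/-! ### Functionals on Sym²W as symmetric forms -/

section Forms

variable {K : Type*} [Field K] {n : ℕ}

/-- The bilinear form on `Kⁿ` attached to a functional on symmetric tensors of the tail. -/
def tailForm {c : ℕ} (ξ : symmTail K n c →ₗ[K] K) : LinearMap.BilinForm K (Fin n → K) :=
  (symmProd K n c).compr₂ ξ

theorem tailForm_apply {c : ℕ} (ξ : symmTail K n c →ₗ[K] K) (v w : Fin n → K) :
    tailForm ξ v w = ξ (symmProd K n c v w) := rfl

theorem tailForm_isSymm {c : ℕ} (ξ : symmTail K n c →ₗ[K] K) : (tailForm ξ).IsSymm :=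
  ⟨fun v w => by rw [tailForm_apply, tailForm_apply, symmProd_comm]⟩

variable [CharZero K]

/-- Products of basis vectors span the symmetric tensors once 2 is invertible, so a functional is
controlled by its form on W. -/
theorem symmTail_eq_sum {c : ℕ} (B : symmTail K n c) :
    B = ∑ i, ∑ j, (B.1 i j / 2) • symmProd K n c (Pi.single i 1) (Pi.single j 1) := by
  have key : ∀ i j, (B.1 i j / 2) • symmProd K n c (Pi.single i 1) (Pi.single j 1) =
      ((B.1 i j / 2) • (Matrix.single i j 1 + Matrix.single j i 1) : Matrix (Fin n) (Fin n) K) := by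
    intro i j
    rcases lt_or_ge (i : ℕ) c with hi | hi
    · rw [B.2.2 i j hi]; simp
    rcases lt_or_ge (j : ℕ) c with hj | hj
    · rw [B.2.1, B.2.2 j i hj]; simp
    congr 1
    refine Matrix.ext fun k l => ?_
    rw [symmProd_apply (single_mem_lastCoords hi 1) (single_mem_lastCoords hj 1)]
    simp only [Matrix.add_apply, Matrix.single_apply, Pi.single_apply]
    have h : ∀ p q : Fin n, (if k = p then (1 : K) else 0) * (if l = q then 1 else 0) =
        if p = k ∧ q = l then 1 else 0 := fun p q => by
      rw [mul_ite, mul_one, mul_zero, ← ite_and]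
      exact if_congr ⟨fun h => ⟨h.2.symm, h.1.symm⟩, fun h => ⟨h.2.symm, h.1.symm⟩⟩ rfl rfl
    rw [h, h]
  refine Subtype.ext ?_
  rw [Submodule.coe_sum]
  simp only [Submodule.coe_sum, Submodule.coe_smul, key, smul_add, Finset.sum_add_distrib]
  have h1 : ∑ i, ∑ j, (B.1 i j / 2) • (Matrix.single i j 1 : Matrix (Fin n) (Fin n) K) =
      (2⁻¹ : K) • B.1 := by
    conv_rhs => rw [Matrix.matrix_eq_sum_single B.1]
    rw [Finset.smul_sum]
    refine Finset.sum_congr rfl fun i _ => ?_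
    rw [Finset.smul_sum]
    refine Finset.sum_congr rfl fun j _ => ?_
    rw [Matrix.smul_single, Matrix.smul_single, smul_eq_mul, smul_eq_mul, mul_one, div_eq_inv_mul]
  have h2 : ∑ i, ∑ j, (B.1 i j / 2) • (Matrix.single j i 1 : Matrix (Fin n) (Fin n) K) =
      (2⁻¹ : K) • B.1 := by
    rw [← h1, Finset.sum_comm]
    exact Finset.sum_congr rfl fun i _ => Finset.sum_congr rfl fun j _ => by rw [B.2.1 j i]
  rw [h1, h2, ← add_smul]
  have : (2⁻¹ + 2⁻¹ : K) = 1 := by norm_num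
  rw [this, one_smul]

theorem stabFunctional_eq {a c : ℕ} (ξ : symmTail K n c →ₗ[K] K) :
    stabFunctional (stabSub (firstCoords K n a) ⊓ stabSub (lastCoords K n c)) (symmAct K n c) ξ =
      stabSub (firstCoords K n a) ⊓ skewStab (lastCoords K n c) (tailForm ξ) := by
  ext A
  rw [mem_stabFunctional]
  constructor
  · rintro ⟨⟨hU, hW⟩, h⟩
    refine ⟨hU, hW, fun w hw w' hw' => ?_⟩
    rw [tailForm_apply, tailForm_apply, ← map_add, ← symmAct_symmProd hW hw hw', h]
  · rintro ⟨hU, hW, h⟩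
    refine ⟨⟨hU, hW⟩, fun B => ?_⟩
    rw [symmTail_eq_sum B]
    simp only [map_sum, map_smul]
    refine Finset.sum_eq_zero fun i _ => Finset.sum_eq_zero fun j _ => ?_
    rcases lt_or_ge (i : ℕ) c with hi | hi
    · rw [B.2.2 i j hi]; simp
    rcases lt_or_ge (j : ℕ) c with hj | hj
    · rw [B.2.1, B.2.2 j i hj]; simp
    have h1 := single_mem_lastCoords (K := K) hi 1
    have h2 := single_mem_lastCoords (K := K) hj 1
    rw [symmAct_symmProd hW h1 h2, map_add]
    have := h _ h1 _ h2
    rw [tailForm_apply, tailForm_apply] at this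
    rw [this, smul_zero]

/-- A radical vector w of Q on a G-stable subspace of W gives the tensor w·w, which obstructs
openness. Conversely the rank one elements of G show column by column that a tensor orthogonal to
the orbit directions vanishes. -/
theorem open_iff_nondegOn {a c : ℕ} (ξ : symmTail K n c →ₗ[K] K) :
    (∀ B, (∀ A ∈ stabSub (firstCoords K n a) ⊓ stabSub (lastCoords K n c),
      ξ (symmAct K n c A B) = 0) → B = 0) ↔
    NondegOn (tailForm ξ) (lastCoords K n c) ∧
      NondegOn (tailForm ξ) (firstCoords K n a ⊓ lastCoords K n c) := by
  constructor
  · intro h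
    have key : ∀ S ≤ lastCoords K n c,
        (∀ A ∈ stabSub (firstCoords K n a) ⊓ stabSub (lastCoords K n c), ∀ v ∈ S, A v ∈ S) →
        NondegOn (tailForm ξ) S := by
      intro S hS hA w hw hww
      have h0 := h (symmProd K n c w w) fun A hAG => by
        have h1 := hww _ (hA A hAG w hw)
        have h2 := (tailForm_isSymm ξ).eq w (A w)
        rw [tailForm_apply] at h1 h2
        rw [tailForm_apply] at h2
        rw [symmAct_symmProd hAG.2 (hS hw) (hS hw), map_add, ← h2, h1, add_zero]
      funext i
      have h1 : (symmProd K n c w w).1 i i = 0 := by rw [h0]; rfl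
      rw [symmProd_apply (hS hw) (hS hw), ← two_mul] at h1
      exact mul_self_eq_zero.mp ((mul_eq_zero.mp h1).resolve_left two_ne_zero)
    exact ⟨key _ le_rfl fun A hA => hA.2,
      key _ inf_le_right fun A hA v hv => ⟨hA.1 v hv.1, hA.2 v hv.2⟩⟩
  · rintro ⟨hW, hM⟩ B hB
    have hact : ∀ u ∈ lastCoords K n c, ∀ j : Fin n,
        (LinearMap.proj j : (Fin n → K) →ₗ[K] K).smulRight u ∈
          stabSub (firstCoords K n a) ⊓ stabSub (lastCoords K n c) →
        tailForm ξ u (fun k => B.1 k j) = 0 := by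
      intro u hu j hmem
      rw [← hB _ hmem, tailForm_apply]
      congr 1
      refine Subtype.ext (Matrix.ext fun k l => ?_)
      rw [symmAct_apply hmem.2, symmProd_apply hu (col_mem_lastCoords B j)]
      simp only [LinearMap.smulRight_apply, LinearMap.proj_apply, Pi.smul_apply, smul_eq_mul]
      rw [B.2.1 j l, B.2.1 j k]
      ring
    have hstW : ∀ u ∈ lastCoords K n c, ∀ j : Fin n,
        (LinearMap.proj j : (Fin n → K) →ₗ[K] K).smulRight u ∈ stabSub (lastCoords K n c) :=
      fun u hu j v _ => Submodule.smul_mem _ _ hu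
    have hsym := (tailForm_isSymm ξ).eq
    -- For j ≥ a the map v ↦ v_j u kills U, so every u in W is allowed and column j vanishes. By
    -- symmetry the remaining columns lie in U ⊓ W, where u in U ⊓ W is enough.
    have h1 : ∀ j : Fin n, a ≤ j → (fun k => B.1 k j) = 0 := fun j hj =>
      hW _ (col_mem_lastCoords B j) fun u hu => by
        rw [hsym]
        refine hact u hu j ⟨fun v hv => ?_, hstW u hu j⟩
        rw [LinearMap.smulRight_apply, LinearMap.proj_apply, hv j hj, zero_smul]
        exact Submodule.zero_mem _
    have h2 : ∀ j : Fin n, (fun k => B.1 k j) = 0 := fun j =>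
      hM _ ⟨fun i hi => (B.2.1 i j).trans (congrFun (h1 i hi) j), col_mem_lastCoords B j⟩ fun u hu => by
        rw [hsym]
        exact hact u hu.2 j ⟨fun v _ => Submodule.smul_mem _ _ hu.1, hstW u hu.2 j⟩
    exact Subtype.ext (Matrix.ext fun i j => congrFun (h2 j) i)

/-- The trace form is nondegenerate on the coordinate subspaces. -/
theorem exists_nondegOn (a c : ℕ) : ∃ ξ : symmTail K n c →ₗ[K] K,
    NondegOn (tailForm ξ) (lastCoords K n c) ∧
      NondegOn (tailForm ξ) (firstCoords K n a ⊓ lastCoords K n c) := by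
  refine ⟨Matrix.traceLinearMap (Fin n) K K ∘ₗ (symmTail K n c).subtype, ?_⟩
  set ξ := Matrix.traceLinearMap (Fin n) K K ∘ₗ (symmTail K n c).subtype
  have hform : ∀ w ∈ lastCoords K n c, ∀ j : Fin n, c ≤ j →
      tailForm ξ w (Pi.single j 1) = 2 * w j := by
    intro w hw j hj
    have : tailForm ξ w (Pi.single j 1) =
        ∑ i, (symmProd K n c w (Pi.single j 1)).1 i i := rfl
    rw [this]
    simp only [symmProd_apply hw (single_mem_lastCoords hj 1), Pi.single_apply, mul_ite, mul_one,
      mul_zero, ite_mul, one_mul, zero_mul, Finset.sum_add_distrib, Finset.sum_ite_eq',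
      Finset.mem_univ, if_true]
    ring
  constructor
  · intro w hw h
    funext i
    rcases lt_or_ge (i : ℕ) c with hi | hi
    · exact hw i hi
    have := h _ (single_mem_lastCoords hi 1)
    rw [hform w hw i hi] at this
    exact (mul_eq_zero.mp this).resolve_left two_ne_zero
  · intro w hw h
    funext i
    rcases lt_or_ge (i : ℕ) c with hi | hi
    · exact hw.2 i hi
    rcases lt_or_ge (i : ℕ) a with hi' | hi'
    · have := h _ ⟨single_mem_firstCoords hi' 1, single_mem_lastCoords hi 1⟩
      rw [hform w hw.2 i hi] at this
      exact (mul_eq_zero.mp this).resolve_left two_ne_zero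
    · exact hw.1 i hi'

end Forms

/-! ### The criterion in coordinates and the conclusion -/

theorem isFrob_stab_coords {K : Type*} [Field K] [CharZero K] {n a b c : ℕ} (hab : a + b = n)
    (hcn : c < n) {Q : LinearMap.BilinForm K (Fin n → K)} (hQ : Q.IsSymm)
    (hW : NondegOn Q (lastCoords K n c))
    (hM : NondegOn Q (firstCoords K n a ⊓ lastCoords K n c)) :
    IsFrob (stabSub (firstCoords K n a) ⊓ skewStab (lastCoords K n c) Q) ↔
      FrobCond (n - c) (Nat.gcd (a + b) (b + c)) := by
  have hU' := finrank_firstCoords (K := K) hab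
  have hW' := finrank_lastCoords (K := K) hcn.le
  have hr : Module.finrank K (lastCoords K n c) = n - c := by omega
  have hn : Module.finrank K (Fin n → K) = n := Module.finrank_fin_fun K
  have hg : Nat.gcd (a + b) (b + c) =
      Int.gcd (Module.finrank K (Fin n → K)) (b - Module.finrank K (lastCoords K n c)) := by
    -- Since r = n - c, the numbers b + c and b - r differ by n = a + b.
    have e : ((b + c : ℕ) : ℤ) = (b - Module.finrank K (lastCoords K n c)) + n := by omega
    rw [hn, hab, ← Int.gcd_natCast_natCast, e, Int.gcd_add_self_right]
  rw [hg, ← hr]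
  rcases le_or_gt a c with hac | hac
  · exact isFrob_stab_disjoint_iff (criterionUpTo _) hQ hW (by omega)
      (disjoint_firstCoords_lastCoords hac) (by omega) (Nat.lt_succ_self _)
  · exact isFrob_stab_codisjoint_iff hQ hW (firstCoords_sup_lastCoords hac.le) hM (by omega)
      (by omega)

/-- For c = n - 3 the parities are automatic: gcd 2 makes n = a + b and b + c even, so c, b and a
are odd in turn. -/
theorem frobCond_iff {n a b c : ℕ} (hab : a + b = n) (hcn : c < n) :
    FrobCond (n - c) (Nat.gcd (a + b) (b + c)) ↔
      (c + 1 = n ∧ Nat.gcd (a + b) (b + c) = 1) ∨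
      (c + 2 = n ∧ Nat.gcd (a + b) (b + c) = 1) ∨
      (c + 3 = n ∧ Odd a ∧ Odd b ∧ Odd c ∧ Nat.gcd (a + b) (b + c) = 2) := by
  have e1 : n - c = 1 ↔ c + 1 = n := by omega
  have e2 : n - c = 2 ↔ c + 2 = n := by omega
  have e3 : n - c = 3 ↔ c + 3 = n := by omega
  rw [FrobCond, e1, e2, e3]
  refine or_congr_right (or_congr_right (and_congr_right fun h3 => ⟨fun h => ?_, fun h => h.2.2.2⟩))
  have h1 : 2 ∣ a + b := h ▸ Nat.gcd_dvd_left _ _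
  have h2 : 2 ∣ b + c := h ▸ Nat.gcd_dvd_right _ _
  simp only [Nat.odd_iff]
  omega

end SymplecticSeaweed

open SymplecticSeaweed in
theorem mainTheorem2 (K : Type*) [Field K] [IsAlgClosed K] [CharZero K]
    (n a b c : ℕ) (ha : 0 < a) (hb : 0 < b) (hc : 0 < c) (hab : a + b = n) (hcn : c ≤ n) :
    SymplecticSeaweed.index K (SymplecticSeaweed.seaweed K n [a, b] [c]) = 0 ↔
      (c + 1 = n ∧ Nat.gcd (a + b) (b + c) = 1) ∨
      (c + 2 = n ∧ Nat.gcd (a + b) (b + c) = 1) ∨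
      (c + 3 = n ∧ Odd a ∧ Odd b ∧ Odd c ∧ Nat.gcd (a + b) (b + c) = 2) := by
  rw [index_eq_zero_iff, isFrob_seaweed_iff hb hab hcn]
  simp only [open_iff_nondegOn, stabFunctional_eq]
  rcases hcn.lt_or_eq with hlt | rfl
  · rw [← frobCond_iff hab hlt]
    constructor
    · rintro ⟨ξ, ⟨hW, hM⟩, hf⟩
      exact (isFrob_stab_coords hab hlt (tailForm_isSymm ξ) hW hM).mp hf
    · intro h
      obtain ⟨ξ, hW, hM⟩ := exists_nondegOn (K := K) (n := n) a c
      exact ⟨ξ, ⟨hW, hM⟩, (isFrob_stab_coords hab hlt (tailForm_isSymm ξ) hW hM).mpr h⟩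
  -- For c = n one has W = 0, so the skew condition is empty and the identity is a nonzero central
  -- element of the stabilizer.
  · refine iff_of_false ?_ (by omega)
    rintro ⟨ξ, -, hf⟩
    have h0 : ∀ w ∈ lastCoords K c c, w = 0 := fun w hw => funext fun i => hw i i.isLt
    have : Nonempty (Fin c) := ⟨⟨0, hc⟩⟩
    have h1 : (1 : Module.End K (Fin c → K)) ∈
        stabSub (firstCoords K c a) ⊓ skewStab (lastCoords K c c) (tailForm ξ) := by
      refine ⟨fun v hv => hv, fun w hw => hw, fun w hw w' _ => ?_⟩
      rw [h0 w hw]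
      simp
    exact not_isFrob_of_central h1 one_ne_zero (fun y _ => by rw [one_mul, mul_one]) hf
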